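/- Let $\lambda$ be a regular uncountable cardinal with $\lambda^{<\lambda}=\lambda$. Let $f:\lambda\to\lambda+1$ satisfy $\omega+\alpha<f(\alpha)$ for all $\alpha<\lambda$. Let $D$ be a normal filter on $\lambda$, i.e. a proper filter that contains the complement of every subset of $\lambda$ of size $<\lambda$ and is closed under diagonal intersections $\triangle_{\alpha<\lambda}A_\alpha=\{\gamma<\lambda:(\forall\alpha<\gamma)\,\gamma\in A_\alpha\}$. Let $\bar Y=\langle Y_\alpha:\alpha<\lambda\rangle$ be an indexing sequence, i.e. $\emptyset\ne Y_\alpha\subseteq{}^{\alpha}\lambda$ and $|Y_\alpha|<\lambda$ for each $\alpha<\lambda$. Then every forcing notion $(\mathbb Q,\le)$ which is $f$-semi-purely proper over $\bar Y$ and $D$ is $\lambda$-proper in the standard sense. The notions used are the following. A *forcing notion* is a set with a reflexive and transitive relation $\le$ (the larger condition is the stronger one) that has a weakest element, to which no other element is equivalent. *Strategic completeness.* For a reflexive transitive relation $\preceq$ on $\mathbb Q$, an ordinal $\gamma$ and $r\in\mathbb Q$, consider the game of length $\gamma$ in which at stage $i<\gamma$ first Incomplete plays $p_i$ and then Complete plays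 $q_i$, so that $r\preceq p_j\preceq q_j\preceq p_i$ for $j<i$; Complete wins if both players have legal moves at every stage $i<\gamma$. $(\mathbb Q,\preceq)$ is strategically $({<}\gamma)$-complete (strategically $({\le}\gamma)$-complete) if for every $r$ Complete has a winning strategy in the game of length $\gamma$ (of length $\gamma+1$, respectively). *Semi-purity.* $(\mathbb Q,\le,\langle\le^\alpha_{\rm pr}:\alpha<\lambda\rangle)$ has $f$-complete semi-purity if $\le$ and all $\le^\alpha_{\rm pr}$ are reflexive and transitive, ${\le^\alpha_{\rm pr}}\subseteq{\le}$, $(\mathbb Q,\le)$ is strategically $({<}\lambda)$-complete, and $(\mathbb Q,\le^\alpha_{\rm pr})$ is strategically $({\le}\kappa)$-complete for every $\alpha<\lambda$ and every infinite cardinal $\kappa<f(\alpha)$. *Aux-generic conditions.* Let $\bar q=\langle q_{\alpha,\eta}:\alpha<\lambda,\ \eta\in Y_\alpha\rangle$ be a system of conditions. A condition $p$ is aux-generic over $\bar q,D$ if COM has a winning strategy in the following game of length $\lambda$. At stage $\alpha<\lambda$ COM plays $(r_\alpha,A_\alpha,\eta_\alpha)$ with $r_\alpha\in\mathbb Q$,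 $A_\alpha\in D$, $\eta_\alpha\in{}^\alpha\lambda$, and then INC plays $r'_\alpha\ge r_\alpha$, so that $p=r_0\le r_\alpha\le r'_\alpha\le r_\beta$, $A_\beta\subseteq A_\alpha$, and $\eta_\alpha$ is a proper initial segment of $\eta_\beta$, for all $\alpha<\beta<\lambda$. COM wins if both players always had legal moves and for every (nonzero) limit ordinal $\gamma\in\triangle_{\alpha<\lambda}A_\alpha$ we have $\eta_\gamma\in Y_\gamma$ and $q_{\gamma,\eta_\gamma}\le^\gamma_{\rm pr}r_\gamma$. *Semi-pure properness.* $(\mathbb Q,\le)$ is $f$-semi-purely proper over $\bar Y$ and $D$ if there is a sequence $\langle\le^\alpha_{\rm pr}:\alpha<\lambda\rangle$ such that $(\mathbb Q,\le,\langle\le^\alpha_{\rm pr}:\alpha<\lambda\rangle)$ has $f$-complete semi-purity and for every $p\in\mathbb Q$ Generic has a winning strategy in the following game of length $\lambda$. At stage $\alpha<\lambda$ Generic plays a system $\langle p_{\alpha,\eta}:\eta\in Y_\alpha\rangle$ of pairwise incompatible conditions, and then Antigeneric plays a system $\langle q_{\alpha,\eta}:\eta\in Y_\alpha\rangle$ of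 conditions with $p_{\alpha,\eta}\le^\alpha_{\rm pr}q_{\alpha,\eta}$ for all $\eta\in Y_\alpha$. Generic wins if some condition $p^*\ge p$ is aux-generic over $\langle q_{\alpha,\eta}:\alpha<\lambda,\ \eta\in Y_\alpha\rangle$ and $D$. *Properness.* $\mathbb Q$ is $\lambda$-proper in the standard sense if for every sufficiently large regular cardinal $\chi$ and every well-ordering $<^*_\chi$ of $\mathcal H(\chi)$ (the family of all sets hereditarily of size less than $\chi$) there is $x\in\mathcal H(\chi)$ such that, for every $N\prec(\mathcal H(\chi),\in,<^*_\chi)$ with ${}^{<\lambda}N\subseteq N$, $|N|=\lambda$ and $\mathbb Q,x\in N$, and every $q\in N\cap\mathbb Q$, there is a condition $p\ge q$ such that $p\Vdash\tau\in N$ for every $\mathbb Q$-name $\tau\in N$ for an ordinal. -/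

import Mathlib

open Cardinal Ordinal

universe u v

/-! ## Ordinals below `lam`, normal filters, indexing sequences -/

/-- The cardinal `lam` viewed as the set of all ordinals below it. -/
abbrev Below (lam : Cardinal.{u}) : Type (u + 1) := Set.Iio lam.ord

/-- The set `{}^α lam` of all sequences of length `α` with values in `lam`. -/
abbrev SeqOf {lam : Cardinal.{u}} (α : Below lam) : Type (u + 1) := Set.Iio α → Below lam

/-- The diagonal intersection of a sequence of subsets of `lam`. -/
def diagInter {lam : Cardinal.{u}} (A : Below lam → Set (Below lam)) : Set (Below lam) :=
  {γ | ∀ α, α < γ → γ ∈ A α}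

/-- Normal filters on `lam`: proper filters which are uniform (they contain the complements of all
sets of size less than `lam`) and closed under diagonal intersections. -/
structure IsNormalFilter {lam : Cardinal.{u}} (D : Filter (Below lam)) : Prop where
  proper : D.NeBot
  uniform : ∀ A : Set (Below lam), #A < Cardinal.lift.{u + 1} lam → Aᶜ ∈ D
  diag : ∀ A : Below lam → Set (Below lam), (∀ α, A α ∈ D) → diagInter A ∈ D

/-- Indexing sequences `⟨Y_α : α < lam⟩`: `∅ ≠ Y_α ⊆ {}^α lam` and `|Y_α| < lam`. -/
structure IsIndexing {lam : Cardinal.{u}} (Y : ∀ α : Below lam, Set (SeqOf α)) : Prop where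
  nonempty : ∀ α, (Y α).Nonempty
  card_lt : ∀ α, #(Y α) < Cardinal.lift.{u + 1} lam

/-! ## Strategic completeness

In every game below, a strategy of a player is a function which computes the move of this player
from the moves which the opponent has made so far (the earlier moves of the player herself are
determined by the strategy and by the moves of the opponent). -/

section Games

variable {Q : Type v}

/-- Complete has a winning strategy in the game of length `γ` on `(Q, le)` above `r`: at stage
`i < γ` first Incomplete plays `p i` and then Complete plays `q i`, where
`r ≤ p j ≤ q j ≤ p i` for `j < i`; Complete wins if both players have a legal move
at every stage `i < γ`. -/
def CompleteWins (le : Q → Q → Prop) (γ : Ordinal.{u}) (r : Q) : Prop :=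
  ∃ S : ∀ i : Ordinal.{u}, (∀ j, j ≤ i → Q) → Q,
    ∀ p q : Ordinal.{u} → Q, (∀ i, q i = S i (fun j _ => p j)) →
      ∀ i, i < γ →
        (∀ j, j < i → le r (p j) ∧ ∀ k, k < j → le (q k) (p j)) →
          (∃ a, le r a ∧ ∀ j, j < i → le (q j) a) ∧
          (le r (p i) → (∀ j, j < i → le (q j) (p i)) → le (p i) (q i))

/-- `(Q, le)` is strategically `(<γ)`-complete. -/
def StrategicallyLTComplete (le : Q → Q → Prop) (γ : Ordinal.{u}) : Prop :=
  ∀ r, CompleteWins le γ r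

/-- `(Q, le)` is strategically `(≤γ)`-complete. -/
def StrategicallyLEComplete (le : Q → Q → Prop) (γ : Ordinal.{u}) : Prop :=
  ∀ r, CompleteWins le (γ + 1) r

/-! ## Semi-purity -/

variable {lam : Cardinal.{u}}

/-- `(Q, le, pr)` is a forcing notion with `f`-complete semi-purity. -/
structure IsSemiPure (f : Below lam → Set.Iic lam.ord)
    (le : Q → Q → Prop) (pr : Below lam → Q → Q → Prop) : Prop where
  le_refl : ∀ a, le a a
  le_trans : ∀ a b c, le a b → le b c → le a c
  pr_refl : ∀ α a, pr α a a
  pr_trans : ∀ α a b c, pr α a b → pr α b c → pr α a c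
  pr_le : ∀ α a b, pr α a b → le a b
  le_complete : StrategicallyLTComplete le lam.ord
  pr_complete : ∀ (α : Below lam) (κ : Cardinal.{u}), ℵ₀ ≤ κ → κ.ord < (f α : Ordinal.{u}) →
    StrategicallyLEComplete (pr α) κ.ord

/-- A move of COM at stage `α` of the auxiliary game: the terms `r_α`, `A_α`, `η_α`. -/
structure AuxMove (Q : Type v) {lam : Cardinal.{u}} (α : Below lam) where
  /-- the condition `r_α` -/
  cond : Q
  /-- the set `A_α` -/
  set : Set (Below lam)
  /-- the sequence `η_α` of length `α` -/
  seq : SeqOf α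

/-- The moves `m β`, `β ≤ α`, of COM and `r' β`, `β < α`, of INC being given, the move `m α` is
legal for COM. -/
structure AuxLegal (le : Q → Q → Prop) (D : Filter (Below lam)) (p : Q)
    (m : ∀ α : Below lam, AuxMove Q α) (r' : Below lam → Q) (α : Below lam) : Prop where
  start : (∀ β, ¬ β < α) → (m α).cond = p
  above : le p (m α).cond
  step : ∀ β, β < α → le (r' β) (m α).cond
  set_mem : (m α).set ∈ D
  set_anti : ∀ β, β < α → (m α).set ⊆ (m β).set
  seq_ext : ∀ β (h : β < α), ∀ ξ (hξ : ξ < β),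
    (m β).seq ⟨ξ, hξ⟩ = (m α).seq ⟨ξ, lt_trans hξ h⟩

/-- The condition `p` is aux-generic over the system `q = ⟨q_{α,η} : α < lam, η ∈ Y_α⟩` and `D`:
COM has a winning strategy in the auxiliary game. At stage `α < lam` of this game COM plays
`(r_α, A_α, η_α)` and then INC plays a condition `r'_α ≥ r_α` (which exists as `le` is
reflexive). COM wins if the play lasts `lam` steps and for every limit `γ` in the diagonal
intersection of the sets `A_α` we have `η_γ ∈ Y_γ` and `r_γ` is `γ`-purely stronger than
`q_{γ,η_γ}`. -/
def AuxGeneric (le : Q → Q → Prop) (pr : Below lam → Q → Q → Prop) (D : Filter (Below lam))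
    (Y : ∀ α : Below lam, Set (SeqOf α)) (q : ∀ α : Below lam, Y α → Q) (p : Q) : Prop :=
  ∃ S : ∀ α : Below lam, (∀ β, β < α → Q) → AuxMove Q α,
    ∀ (r' : Below lam → Q) (m : ∀ α : Below lam, AuxMove Q α),
      (∀ α, m α = S α (fun β _ => r' β)) →
        (∀ α, (∀ β, β < α → le (m β).cond (r' β)) → AuxLegal le D p m r' α) ∧
        ((∀ α, le (m α).cond (r' α)) →
          ∀ γ : Below lam, Order.IsSuccLimit (γ : Ordinal.{u}) →
            γ ∈ diagInter (fun α => (m α).set) →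
              ∃ h : (m γ).seq ∈ Y γ, pr γ (q γ ⟨(m γ).seq, h⟩) (m γ).cond)

/-- Generic has a winning strategy in the main game at `p`. At stage `α < lam` of this game Generic
plays a system `⟨p_{α,η} : η ∈ Y_α⟩` of pairwise incompatible conditions and Antigeneric answers
with a system `⟨q_{α,η} : η ∈ Y_α⟩` such that `q_{α,η}` is `α`-purely stronger than `p_{α,η}`
(such systems exist as `pr α` is reflexive). Generic wins if there is a condition `≥ p` which is
aux-generic over the system of all `q_{α,η}` and `D`. -/
def GenericWins (le : Q → Q → Prop) (pr : Below lam → Q → Q → Prop) (D : Filter (Below lam))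
    (Y : ∀ α : Below lam, Set (SeqOf α)) (p : Q) : Prop :=
  ∃ S : ∀ α : Below lam, (∀ β, β < α → Y β → Q) → Y α → Q,
    ∀ (q P : ∀ α : Below lam, Y α → Q), (∀ α, P α = S α (fun β _ => q β)) →
      (∀ α, (∀ β, β < α → ∀ η, pr β (P β η) (q β η)) →
        ∀ η ν, η ≠ ν → ¬ ∃ c, le (P α η) c ∧ le (P α ν) c) ∧
      ((∀ α η, pr α (P α η) (q α η)) →
        ∃ p', le p p' ∧ AuxGeneric le pr D Y q p')

/-- `(Q, le)` is `f`-semi-purely proper over `Y` and `D`. -/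
def SemiPurelyProper (f : Below lam → Set.Iic lam.ord) (Y : ∀ α : Below lam, Set (SeqOf α))
    (D : Filter (Below lam)) (le : Q → Q → Prop) : Prop :=
  ∃ pr : Below lam → Q → Q → Prop, IsSemiPure f le pr ∧ ∀ p, GenericWins le pr D Y p

end Games

/-! ## Forcing notions, names and the forcing relation

The universe of set theory is `ZFSet`. -/

/-- A forcing notion is a set with a transitive and reflexive relation on it (the larger condition
is the stronger one) which has a weakest element, equivalent to no other element. -/
structure ForcingNotion where
  /-- the set of conditions -/
  carrier : ZFSet.{u}
  /-- the order, as a set of pairs -/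
  rel : ZFSet.{u}
  /-- the weakest condition -/
  bot : ZFSet.{u}
  rel_subset : rel ⊆ ZFSet.prod carrier carrier
  refl : ∀ p ∈ carrier, ZFSet.pair p p ∈ rel
  trans : ∀ p q r, ZFSet.pair p q ∈ rel → ZFSet.pair q r ∈ rel → ZFSet.pair p r ∈ rel
  bot_mem : bot ∈ carrier
  bot_le : ∀ p ∈ carrier, ZFSet.pair bot p ∈ rel
  bot_unique : ∀ p ∈ carrier, ZFSet.pair p bot ∈ rel → p = bot

theorem ZFSet.rank_fst_lt_of_pair_mem {x y z : ZFSet.{u}} (h : ZFSet.pair x y ∈ z) :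
    x.rank < z.rank := by
  have h1 : x ∈ ({x} : ZFSet.{u}) := by simp
  have h2 : ({x} : ZFSet.{u}) ∈ ZFSet.pair x y := by simp [ZFSet.pair]
  exact ((ZFSet.rank_lt_of_mem h1).trans (ZFSet.rank_lt_of_mem h2)).trans (ZFSet.rank_lt_of_mem h)

namespace ForcingNotion

variable (Q : ForcingNotion.{u})

/-- The type of conditions. -/
abbrev Cond : Type (u + 1) := {p : ZFSet.{u} // p ∈ Q.carrier}

/-- The order on conditions; `Q.Le p q` means that `q` is stronger than `p`. -/
def Le (p q : Q.Cond) : Prop := ZFSet.pair p.1 q.1 ∈ Q.rel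

/-- The forcing notion `(Q, ≤)` as an element of the universe. -/
def toSet : ZFSet.{u} := ZFSet.pair Q.carrier Q.rel

/-- `τ` is a `Q`-name: all its elements are pairs consisting of a `Q`-name and a condition. -/
inductive IsName : ZFSet.{u} → Prop
  | mk (τ : ZFSet.{u}) (h₁ : ∀ x ∈ τ, ∃ (σ : ZFSet.{u}) (s : Q.Cond), x = ZFSet.pair σ s.1)
      (h₂ : ∀ (σ : ZFSet.{u}) (s : Q.Cond), ZFSet.pair σ s.1 ∈ τ → IsName σ) : IsName τ

/-- The canonical name of a set `z` of the ground model. -/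
noncomputable def check (z : ZFSet.{u}) : ZFSet.{u} :=
  ZFSet.range (fun w : Shrink.{u} z =>
    ZFSet.pair (check ((equivShrink z).symm w).1) Q.bot)
termination_by z
decreasing_by exact ((equivShrink z).symm w).2

theorem mem_check {z x : ZFSet.{u}} :
    x ∈ Q.check z ↔ ∃ w ∈ z, x = ZFSet.pair (Q.check w) Q.bot := by
  rw [check, ZFSet.mem_range]
  constructor
  · rintro ⟨w, rfl⟩
    exact ⟨_, ((equivShrink z).symm w).2, rfl⟩
  · rintro ⟨w, hw, rfl⟩
    exact ⟨equivShrink z ⟨w, hw⟩, by simp⟩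

/-- `Q.ForcesEq σ τ p` is `p ⊩ σ = τ`, for `Q`-names `σ`, `τ`: whenever `(π, s) ∈ σ`, it is dense
above every common extension of `p` and `s` to force `π = π'` for some `(π', s') ∈ τ` with
`s'` weaker than the forcing condition, and conversely. -/
def ForcesEq (σ τ : ZFSet.{u}) (p : Q.Cond) : Prop :=
  (∀ (π : ZFSet.{u}) (s : Q.Cond), ∀ _h : ZFSet.pair π s.1 ∈ σ, ∀ q, Q.Le p q → Q.Le s q →
    ∃ r, Q.Le q r ∧ ∃ (π' : ZFSet.{u}) (s' : Q.Cond),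
      ZFSet.pair π' s'.1 ∈ τ ∧ Q.Le s' r ∧ ForcesEq π π' r) ∧
  (∀ (π' : ZFSet.{u}) (s' : Q.Cond), ZFSet.pair π' s'.1 ∈ τ → ∀ q, Q.Le p q → Q.Le s' q →
    ∃ r, Q.Le q r ∧ ∃ (π : ZFSet.{u}) (s : Q.Cond), ∃ _h : ZFSet.pair π s.1 ∈ σ,
      Q.Le s r ∧ ForcesEq π π' r)
termination_by σ.rank
decreasing_by all_goals exact ZFSet.rank_fst_lt_of_pair_mem _h

/-- `Q.ForcesMem σ τ p` is `p ⊩ σ ∈ τ`, for `Q`-names `σ`, `τ`. -/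
def ForcesMem (σ τ : ZFSet.{u}) (p : Q.Cond) : Prop :=
  ∀ q, Q.Le p q → ∃ r, Q.Le q r ∧ ∃ (π : ZFSet.{u}) (s : Q.Cond),
    ZFSet.pair π s.1 ∈ τ ∧ Q.Le s r ∧ Q.ForcesEq σ π r

/-- `p ⊩ "τ is a transitive set"`, that is, `p ⊩ ∀ x y, x ∈ τ → y ∈ x → y ∈ τ`. -/
def ForcesTransitive (τ : ZFSet.{u}) (p : Q.Cond) : Prop :=
  ∀ x y, Q.IsName x → Q.IsName y → ∀ q, Q.Le p q →
    Q.ForcesMem x τ q → Q.ForcesMem y x q → Q.ForcesMem y τ q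

/-- `p ⊩ "τ is an ordinal"`, that is, `p` forces that `τ` is a transitive set all of whose elements
are transitive sets. -/
def ForcesOrdinal (τ : ZFSet.{u}) (p : Q.Cond) : Prop :=
  Q.ForcesTransitive τ p ∧
    ∀ x, Q.IsName x → ∀ q, Q.Le p q → Q.ForcesMem x τ q → Q.ForcesTransitive x q

/-- `τ` is a `Q`-name for an ordinal. -/
def IsOrdinalName (τ : ZFSet.{u}) : Prop :=
  Q.IsName τ ∧ ∀ p, Q.ForcesOrdinal τ p

/-- `p` is `(N, Q)`-generic in the standard sense: `p ⊩ τ ∈ N` for every `Q`-name `τ ∈ N` for an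
ordinal. -/
def IsGenericCond (N : ZFSet.{u}) (p : Q.Cond) : Prop :=
  ∀ τ ∈ N, Q.IsOrdinalName τ → Q.ForcesMem τ (Q.check N) p

end ForcingNotion

/-! ## Elementary submodels of `(H(χ), ∈, <*)` and properness -/

/-- The family of all sets hereditarily of size less than `χ`. -/
def HSet (χ : Cardinal.{u}) : Set ZFSet.{u} :=
  {x | ZFSet.Hereditarily (fun y => y.card < χ) x}

/-- The symbols of the language with two binary relation symbols `∈` and `<*`. -/
inductive HRel : ℕ → Type
  | mem : HRel 2
  | lt : HRel 2

/-- The first-order language with two binary relation symbols `∈` and `<*`. -/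
def hLang : FirstOrder.Language.{0, 0} := ⟨fun _ => Empty, HRel⟩

/-- The structure `(H(χ), ∈, W)`. -/
@[reducible]
def hStructure (χ : Cardinal.{u}) (W : HSet χ → HSet χ → Prop) : hLang.Structure (HSet χ) where
  funMap := fun F _ => Empty.elim F
  RelMap := fun R x =>
    match R, x with
    | HRel.mem, x => (x 0).1 ∈ (x 1).1
    | HRel.lt, x => W (x 0) (x 1)

/-- `N` is (the universe of) an elementary submodel of `(H(χ), ∈, W)`. -/
def IsElementarySubmodel (χ : Cardinal.{u}) (W : HSet χ → HSet χ → Prop) (N : ZFSet.{u}) : Prop :=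
  letI := hStructure χ W
  ∃ M : hLang.ElementarySubstructure (HSet χ),
    ∀ x : ZFSet.{u}, x ∈ N ↔ ∃ h : x ∈ HSet χ, (⟨x, h⟩ : HSet χ) ∈ M

/-- `Q` is `lam`-proper in the standard sense: for all sufficiently large regular cardinals `χ` and
every well-ordering `W` of `H(χ)` there is `x ∈ H(χ)` such that, for every elementary submodel `N`
of `(H(χ), ∈, W)` of size `lam` which is closed under sequences of length less than `lam` and
contains `Q` and `x`, every condition in `N` has a stronger `(N, Q)`-generic condition. -/
def ForcingNotion.IsProper (Q : ForcingNotion.{u}) (lam : Cardinal.{u}) : Prop :=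
  ∃ χ₀ : Cardinal.{u}, ∀ χ : Cardinal.{u}, χ₀ ≤ χ → χ.IsRegular →
    ∀ W : HSet χ → HSet χ → Prop, IsWellOrder (HSet χ) W →
      ∃ x ∈ HSet χ, ∀ N : ZFSet.{u}, IsElementarySubmodel χ W N →
        (∀ α : Ordinal.{u}, α < lam.ord → ∀ F, ZFSet.IsFunc α.toZFSet N F → F ∈ N) →
        N.card = lam → Q.toSet ∈ N → x ∈ N →
          ∀ q : Q.Cond, q.1 ∈ N → ∃ p : Q.Cond, Q.Le q p ∧ Q.IsGenericCond N p

/-!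
Let `N` be an elementary submodel as in the definition of properness, and list the sets of
conditions in `N` as `⟨E_β : β < lam⟩`; only the upward closed dense ones matter. Generic follows
a winning strategy of the main game above the given condition, and at stage `α` Antigeneric
replaces `p_{α,η}` by an `α`-pure extension `q_{α,η}` which lies in `E_β` for every `β < α` such
that some `α`-pure extension of `q_{α,η}` lies in `E_β`; strategic completeness of the pure order
handles the fewer than `f α` many sets (`CompleteWins.exists_forall_mem`,
`IsSemiPure.exists_pure`). The resulting aux-generic condition `p'` is `N`-generic. Indeed, given
`r ≥ p'` in `E_β`, let INC open the auxiliary game with `r`. By normality of `D` there is a limit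
`γ > β` in the diagonal intersection (`AuxGeneric.exists_pure_le`), and there `q_{γ,η}` has a
`γ`-pure extension `r_γ ≥ r`, which lies in `E_β`. So `q_{γ,η}` itself lies in `E_β`, and it is
compatible with `r` (`SemiPurelyProper.exists_play`).

It remains to see that `q_{α,η} ∈ N`. By construction `q_{α,η}` depends only on the initial
condition and on `⟨E_β : β < α⟩`. Hence a single set function `x`, chosen before `N`, computes it from
a sequence of length less than `lam`; this sequence is in `N` because `N` is closed under such
sequences, its length codes the pair `(α, η)`, and so `x ∈ N` puts the value into `N`.

A name `τ ∈ N` for an ordinal is connected with a dense set in `N` as follows. Densely many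
conditions force `τ` to be equal to a set of the ground model
(`ForcingNotion.ForcesOrdinal.exists_forcesEq_check`). Rather than defining the forcing relation
inside `H(χ)`, one reflects into `N` the existence of a set of triples that is closed under unfolding
the clauses of the forcing relation (`IsDecisionSystem`): this is a simple first-order property, and
by well-foundedness it makes all triples in the set correct.
-/

/-! ### Pure extensions meeting few dense sets -/

section Games

variable {Q : Type v} {lam : Cardinal.{u}}

/-- Along a run of the completeness game whose Incomplete enters the sets `E i` whenever possible,
every set of the family that can still be entered has been entered. -/
theorem CompleteWins.exists_forall_mem {le : Q → Q → Prop}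
    (htrans : ∀ a b c, le a b → le b c → le a c) {δ : Ordinal.{u}} {r : Q}
    (h : CompleteWins le (δ + 1) r) (E : Ordinal.{u} → Set Q) :
    ∃ a, le r a ∧ ∀ i < δ, (∀ b c, b ∈ E i → le b c → c ∈ E i) →
      (∃ b, le a b ∧ b ∈ E i) → a ∈ E i := by
  classical
  obtain ⟨S, hS⟩ := h
  -- the positions that are legal for Incomplete after the answers `q j`, `j < i`
  let L : ∀ i : Ordinal.{u}, (∀ j, j < i → Q) → Set Q :=
    fun i q => {a | le r a ∧ ∀ j (hj : j < i), le (q j hj) a}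
  have key : ∀ i (q : ∀ j, j < i → Q), ∃ a, ((L i q).Nonempty → a ∈ L i q) ∧
      ((L i q ∩ E i).Nonempty → a ∈ E i) := by
    intro i q
    by_cases h1 : (L i q ∩ E i).Nonempty
    · exact ⟨h1.some, fun _ => h1.some_mem.1, fun _ => h1.some_mem.2⟩
    · by_cases h2 : (L i q).Nonempty
      · exact ⟨h2.some, fun _ => h2.some_mem, fun h => absurd h h1⟩
      · exact ⟨r, fun h => absurd h h2, fun h => absurd h h1⟩
  choose mv hmv1 hmv2 using key
  -- Incomplete's play, as a function of Complete's strategy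
  let step : ∀ i : Ordinal.{u}, (∀ j, j < i → Q × Q) → Q × Q := fun i ih =>
    let a := mv i (fun j hj => (ih j hj).2)
    (a, S i (fun j _ => if hj : j < i then (ih j hj).1 else a))
  let pq : Ordinal.{u} → Q × Q := Ordinal.lt_wf.fix step
  have hpq : ∀ i, pq i = step i (fun j _ => pq j) := fun i => Ordinal.lt_wf.fix_eq step i
  let p : Ordinal.{u} → Q := fun i => (pq i).1
  let q : Ordinal.{u} → Q := fun i => (pq i).2
  have hp : ∀ i, p i = mv i (fun j _ => q j) := fun i => by
    change (pq i).1 = _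
    rw [hpq]
  have hq : ∀ i, q i = S i (fun j _ => p j) := fun i => by
    change (pq i).2 = _
    rw [hpq]
    change S i _ = S i _
    congr 1
    funext j hj
    split_ifs with hlt
    · rfl
    · obtain rfl : j = i := le_antisymm hj (not_lt.1 hlt)
      exact (hp j).symm
  have hwin := hS p q hq
  have hlegal : ∀ i, i < δ + 1 →
      (L i (fun j _ => q j)).Nonempty ∧ p i ∈ L i (fun j _ => q j) ∧ le (p i) (q i) := by
    intro i
    induction i using Ordinal.lt_wf.induction with
    | _ i ih =>
      intro hi
      have h1 := hwin i hi (fun j hj => by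
        have := (ih j hj (hj.trans hi)).2.1
        exact ⟨this.1, fun k hk => this.2 k hk⟩)
      have hne : (L i (fun j _ => q j)).Nonempty := h1.1
      have hm : p i ∈ L i (fun j _ => q j) := by
        rw [hp i]
        exact hmv1 _ _ hne
      exact ⟨hne, hm, h1.2 hm.1 hm.2⟩
  obtain ⟨a, hra, ha⟩ := (hlegal δ (Order.lt_add_one_iff.2 le_rfl)).1
  refine ⟨a, hra, fun i hi hup ⟨b, hab, hb⟩ => ?_⟩
  have hpi : p i ∈ E i := by
    rw [hp i]
    exact hmv2 _ _ ⟨b, ⟨htrans _ _ _ hra hab,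
      fun j hj => htrans _ _ _ (ha j (hj.trans hi)) hab⟩, hb⟩
  exact hup _ _ hpi (htrans _ _ _ (hlegal i (hi.trans (Order.lt_add_one_iff.2 le_rfl))).2.2
    (ha i hi))

/-- Semi-purity in the form in which it is used: every condition has an
`α`-pure extension which enters each of the sets `E β`, `β < α`, that its `α`-pure extensions
enter. Here `ω + α < f α` provides an infinite cardinal `κ < f α` of size at least `α`. -/
theorem IsSemiPure.exists_pure {f : Below lam → Set.Iic lam.ord} {le : Q → Q → Prop}
    {pr : Below lam → Q → Q → Prop} (h : IsSemiPure f le pr)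
    (hf : ∀ α : Below lam, ω + (α : Ordinal.{u}) < f α)
    (α : Below lam) (r : Q) (E : ∀ β, β < α → Set Q) :
    ∃ a, pr α r a ∧ ∀ β (hβ : β < α), (∀ b c, b ∈ E β hβ → le b c → c ∈ E β hβ) →
      (∃ b, pr α a b ∧ b ∈ E β hβ) → a ∈ E β hβ := by
  classical
  set κ : Cardinal.{u} := (ω + (α : Ordinal.{u})).card with hκ
  have hκω : ℵ₀ ≤ κ := by
    rw [← card_omega0]
    exact Ordinal.card_le_card le_self_add
  have hκf : κ.ord < (f α : Ordinal.{u}) := (ord_card_le _).trans_lt (hf α)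
  have hcard : #(Set.Iio (α : Ordinal.{u})) ≤ #(Set.Iio κ.ord) := by
    rw [Cardinal.mk_Iio_ordinal, Cardinal.mk_Iio_ordinal, card_ord, Cardinal.lift_le]
    exact Ordinal.card_le_card le_add_self
  obtain ⟨e⟩ := hcard
  -- the `i`-th set to enter: `E β` for the unique `β` with `e β = i`
  let F : Ordinal.{u} → Set Q := fun i =>
    {b | ∃ (β : Below lam) (hβ : β < α), (e ⟨β, hβ⟩ : Ordinal.{u}) = i ∧ b ∈ E β hβ}
  have hF : ∀ β (hβ : β < α), F (e ⟨β, hβ⟩ : Ordinal.{u}) = E β hβ := by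
    intro β hβ
    ext b
    constructor
    · rintro ⟨β', hβ', h1, h2⟩
      have := congrArg Subtype.val (e.injective (Subtype.ext h1))
      obtain rfl : β' = β := Subtype.ext this
      exact h2
    · exact fun hb => ⟨β, hβ, rfl, hb⟩
  obtain ⟨a, hra, ha⟩ := (h.pr_complete α κ hκω hκf r).exists_forall_mem (h.pr_trans α) F
  refine ⟨a, hra, fun β hβ hup hex => ?_⟩
  have := ha (e ⟨β, hβ⟩) (e ⟨β, hβ⟩).2
  rw [hF] at this
  exact this (fun b c hb hbc => hup b c hb (h.pr_le _ _ _ hbc)) hex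

/-! ### The auxiliary game -/

/-- The diagonal intersection of the final segments `(α + 1, lam)` has only limit ordinals as
nonzero elements. -/
theorem IsNormalFilter.limit_mem {D : Filter (Below lam)} (hlam : ℵ₀ ≤ lam)
    (hD : IsNormalFilter D) (β : Below lam) :
    {γ : Below lam | Order.IsSuccLimit (γ : Ordinal.{u}) ∧ β < γ} ∈ D := by
  have hlim : Order.IsSuccLimit lam.ord := isSuccLimit_ord hlam
  have htail : ∀ α : Below lam, {γ : Below lam | α < γ} ∈ D := by
    intro α
    have h1 : {γ : Below lam | α < γ} = (Set.Iic α)ᶜ := by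
      ext γ
      simp
    rw [h1]
    apply hD.uniform
    have h2 : #(Set.Iic α) ≤ #(Set.Iio ((α : Ordinal.{u}) + 1)) := by
      let g : Set.Iic α → Set.Iio ((α : Ordinal.{u}) + 1) := fun x =>
        ⟨x.1.1, Set.mem_Iio.2 (Order.lt_add_one_iff.2 (Subtype.coe_le_coe.2 x.2))⟩
      refine Cardinal.mk_le_of_injective (f := g) ?_
      intro x y hxy
      have := congrArg Subtype.val hxy
      exact Subtype.ext (Subtype.ext this)
    refine h2.trans_lt ?_
    rw [Cardinal.mk_Iio_ordinal, Cardinal.lift_lt, ← lt_ord]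
    exact hlim.add_one_lt α.2
  let suc : Below lam → Below lam := fun α => ⟨(α : Ordinal.{u}) + 1, hlim.add_one_lt α.2⟩
  have hdiag := hD.diag (fun α => {γ | suc α < γ}) (fun α => htail _)
  filter_upwards [hdiag, htail β] with γ hγ hβγ
  refine ⟨isSuccLimit_iff.2 ⟨?_, Order.isSuccPrelimit_of_succ_lt fun a ha => ?_⟩, hβγ⟩
  · exact (lt_of_le_of_lt (zero_le (a := (β : Ordinal.{u}))) hβγ).ne'
  · exact hγ ⟨a, ha.trans γ.2⟩ ha

/-- The consequence of aux-genericity obtained by letting INC open with `r` and repeat COM's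
conditions afterwards. -/
theorem AuxGeneric.exists_pure_le {le : Q → Q → Prop} {pr : Below lam → Q → Q → Prop}
    {D : Filter (Below lam)} {Y : ∀ α : Below lam, Set (SeqOf α)} {q : ∀ α : Below lam, Y α → Q}
    {p : Q} (hlam : ℵ₀ ≤ lam) (hrefl : ∀ a, le a a)
    (hD : IsNormalFilter D) (h : AuxGeneric le pr D Y q p)
    {r : Q} (hr : le p r) (β : Below lam) :
    ∃ γ, β < γ ∧ ∃ η r', le r r' ∧ pr γ (q γ η) r' := by
  classical
  obtain ⟨S, hS⟩ := h
  let step : ∀ α : Below lam, (∀ β, β < α → Q) → Q := fun α ih =>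
    if ∃ β, β < α then (S α ih).cond else r
  have wf : WellFounded ((· < ·) : Below lam → Below lam → Prop) := wellFounded_lt
  let r' : Below lam → Q := wf.fix step
  have hr' : ∀ α, r' α = step α (fun β _ => r' β) := fun α => wf.fix_eq step α
  let m : ∀ α : Below lam, AuxMove Q α := fun α => S α (fun β _ => r' β)
  obtain ⟨h1, h2⟩ := hS r' m (fun _ => rfl)
  have hle : ∀ α, le (m α).cond (r' α) := by
    intro α
    induction α using wf.induction with
    | _ α ih =>
      have hα := h1 α ih
      rw [hr' α]
      change le _ (if _ then _ else _)
      split_ifs with hne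
      · exact hrefl _
      · rw [hα.start (fun β hβ => hne ⟨β, hβ⟩)]
        exact hr
  have hlegal : ∀ α, AuxLegal le D p m r' α := fun α => h1 α (fun β _ => hle β)
  have hmem := Filter.inter_mem (hD.diag _ (fun α => (hlegal α).set_mem)) (hD.limit_mem hlam β)
  have := hD.proper
  obtain ⟨γ, hγ1, hγ2, hγ3⟩ := Filter.nonempty_of_mem hmem
  obtain ⟨hη, hpr⟩ := h2 hle γ hγ2 hγ1
  refine ⟨γ, hγ3, ⟨_, hη⟩, _, ?_, hpr⟩
  let z : Below lam := ⟨0, Set.mem_Iio.2 (lt_of_le_of_lt zero_le (Set.mem_Iio.1 β.2))⟩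
  have hz : r' z = r := by
    rw [hr' z]
    refine if_neg ?_
    rintro ⟨b, hb⟩
    exact not_lt_bot (α := Ordinal.{u}) (show (b : Ordinal.{u}) < ⊥ from hb)
  rw [← hz]
  exact (hlegal γ).step z (lt_of_le_of_lt (show (0 : Ordinal.{u}) ≤ β from zero_le) hγ3)

/-! ### The main game -/

/-- Semi-pure properness, extracted from the games: after a play in which Antigeneric
enters the given sets `E β` whenever possible, the play captures all the upward closed ones among
them above some `p' ≥ p`. The play is determined by `p` and by the family `E`, and its `α`-th step
depends on `E` only below `α`. -/
theorem SemiPurelyProper.exists_play {f : Below lam → Set.Iic lam.ord}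
    {Y : ∀ α : Below lam, Set (SeqOf α)} {D : Filter (Below lam)} {le : Q → Q → Prop}
    (hlam : ℵ₀ ≤ lam) (hf : ∀ α : Below lam, ω + (α : Ordinal.{u}) < f α)
    (hD : IsNormalFilter D) (h : SemiPurelyProper f Y D le) :
    ∃ play : Q → (Below lam → Set Q) → ∀ α : Below lam, Y α → Q,
      (∀ p E E' α, (∀ β, β < α → E β = E' β) → play p E α = play p E' α) ∧
      ∀ p E, ∃ p', le p p' ∧ ∀ β, (∀ b c, b ∈ E β → le b c → c ∈ E β) →
        ∀ r, le p' r → r ∈ E β → ∃ α η r', le r r' ∧ le (play p E α η) r' ∧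
          play p E α η ∈ E β := by
  obtain ⟨pr, hpr, hG⟩ := h
  choose ext hext1 hext2 using hpr.exists_pure hf
  choose S hS using hG
  let step : Q → (Below lam → Set Q) → ∀ α : Below lam, (∀ β, β < α → Y β → Q) → Y α → Q :=
    fun p E α ih η => ext α (S p α ih η) (fun β _ => E β)
  have wf : WellFounded ((· < ·) : Below lam → Below lam → Prop) := wellFounded_lt
  let play : Q → (Below lam → Set Q) → ∀ α : Below lam, Y α → Q := fun p E => wf.fix (step p E)
  have hplay : ∀ p E α, play p E α = step p E α (fun β _ => play p E β) :=
    fun p E α => wf.fix_eq (step p E) α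
  refine ⟨play, ?_, ?_⟩
  · intro p E E' α
    induction α using wf.induction with
    | _ α ih =>
      intro hE
      have h1 : (fun (β : Below lam) (_ : β < α) => play p E β) = fun β _ => play p E' β := by
        funext β hβ
        exact ih β hβ (fun γ hγ => hE γ (hγ.trans hβ))
      have h2 : (fun (β : Below lam) (_ : β < α) => E β) = fun β _ => E' β := by
        funext β hβ
        exact hE β hβ
      rw [hplay p E, hplay p E', h1]
      funext η
      change ext α _ _ = ext α _ _
      rw [h2]
  · intro p E
    obtain ⟨-, hwin⟩ := hS p (play p E) (fun α => S p α (fun β _ => play p E β)) (fun _ => rfl)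
    obtain ⟨p', hpp', haux⟩ := hwin (fun α η => by
      rw [hplay p E α]
      exact hext1 _ _ _)
    refine ⟨p', hpp', fun β hup r hr hrE => ?_⟩
    obtain ⟨γ, hβγ, η, r', hrr', hγ⟩ :=
      haux.exists_pure_le hlam hpr.le_refl hD hr β
    refine ⟨γ, η, r', hrr', hpr.pr_le _ _ _ hγ, ?_⟩
    rw [hplay p E γ] at hγ ⊢
    exact hext2 γ _ (fun β _ => E β) β hβγ hup ⟨r', hγ, hup _ _ hrE hrr'⟩

end Games

/-! ### The forcing relation -/

namespace ForcingNotion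

variable {Q : ForcingNotion.{u}}

theorem Le.rfl {p : Q.Cond} : Q.Le p p := Q.refl p.1 p.2

theorem Le.trans {p q r : Q.Cond} (h : Q.Le p q) (h' : Q.Le q r) : Q.Le p r :=
  Q.trans _ _ _ h h'

/-- The weakest condition. -/
def botCond (Q : ForcingNotion.{u}) : Q.Cond := ⟨Q.bot, Q.bot_mem⟩

theorem botCond_le (p : Q.Cond) : Q.Le Q.botCond p := Q.bot_le p.1 p.2

theorem pair_mem_check {a σ : ZFSet.{u}} {s : Q.Cond} :
    ZFSet.pair σ s.1 ∈ Q.check a ↔ ∃ b ∈ a, σ = Q.check b ∧ s = Q.botCond := by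
  rw [Q.mem_check]
  constructor
  · rintro ⟨b, hb, h⟩
    obtain ⟨h1, h2⟩ := ZFSet.pair_injective h
    exact ⟨b, hb, h1, Subtype.ext h2⟩
  · rintro ⟨b, hb, rfl, rfl⟩
    exact ⟨b, hb, rfl⟩

theorem isName_check (a : ZFSet.{u}) : Q.IsName (Q.check a) := by
  induction a using ZFSet.inductionOn with
  | _ a ih =>
    constructor
    · intro x hx
      obtain ⟨w, -, rfl⟩ := (Q.mem_check).1 hx
      exact ⟨_, Q.botCond, rfl⟩
    · intro σ s h
      obtain ⟨b, hb, rfl, -⟩ := pair_mem_check.1 h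
      exact ih b hb

theorem IsName.of_pair_mem {τ σ : ZFSet.{u}} {s : Q.Cond} (h : Q.IsName τ)
    (hσ : ZFSet.pair σ s.1 ∈ τ) : Q.IsName σ := by
  cases h with
  | mk _ h₁ h₂ => exact h₂ σ s hσ

theorem ForcesEq.mono {σ τ : ZFSet.{u}} {p q : Q.Cond} (h : Q.ForcesEq σ τ p) (hpq : Q.Le p q) :
    Q.ForcesEq σ τ q := by
  rw [ForcesEq] at h ⊢
  exact ⟨fun π s hπ r hr => h.1 π s hπ r (hpq.trans hr), fun π s hπ r hr =>
    h.2 π s hπ r (hpq.trans hr)⟩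

theorem ForcesMem.mono {σ τ : ZFSet.{u}} {p q : Q.Cond} (h : Q.ForcesMem σ τ p) (hpq : Q.Le p q) :
    Q.ForcesMem σ τ q :=
  fun r hr => h r (hpq.trans hr)

theorem ForcesTransitive.mono {τ : ZFSet.{u}} {p q : Q.Cond} (h : Q.ForcesTransitive τ p)
    (hpq : Q.Le p q) : Q.ForcesTransitive τ q :=
  fun x y hx hy r hr => h x y hx hy r (hpq.trans hr)

theorem ForcesOrdinal.mono {τ : ZFSet.{u}} {p q : Q.Cond} (h : Q.ForcesOrdinal τ p)
    (hpq : Q.Le p q) : Q.ForcesOrdinal τ q :=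
  ⟨h.1.mono hpq, fun x hx r hr => h.2 x hx r (hpq.trans hr)⟩

theorem ForcesEq.refl (σ : ZFSet.{u}) (p : Q.Cond) : Q.ForcesEq σ σ p := by
  induction hn : σ.rank using Ordinal.lt_wf.induction generalizing σ p with
  | _ n ih =>
    subst hn
    rw [ForcesEq]
    exact ⟨fun π s hπ q _ hs => ⟨q, .rfl, π, s, hπ, hs,
        ih _ (ZFSet.rank_fst_lt_of_pair_mem hπ) _ _ rfl⟩,
      fun π s hπ q _ hs => ⟨q, .rfl, π, s, hπ, hs,
        ih _ (ZFSet.rank_fst_lt_of_pair_mem hπ) _ _ rfl⟩⟩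

theorem forcesEq_comm {σ τ : ZFSet.{u}} {p : Q.Cond} :
    Q.ForcesEq σ τ p ↔ Q.ForcesEq τ σ p := by
  induction hn : σ.rank using Ordinal.lt_wf.induction generalizing σ τ p with
  | _ n ih =>
    subst hn
    rw [ForcesEq, ForcesEq]
    constructor
    · rintro ⟨h1, h2⟩
      refine ⟨fun π s hπ q hq hs => ?_, fun π s hπ q hq hs => ?_⟩
      · obtain ⟨r, hr, π', s', hπ', hs', h⟩ := h2 π s hπ q hq hs
        exact ⟨r, hr, π', s', hπ', hs', (ih _ (ZFSet.rank_fst_lt_of_pair_mem hπ') rfl).1 h⟩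
      · obtain ⟨r, hr, π', s', hπ', hs', h⟩ := h1 π s hπ q hq hs
        exact ⟨r, hr, π', s', hπ', hs', (ih _ (ZFSet.rank_fst_lt_of_pair_mem hπ) rfl).1 h⟩
    · rintro ⟨h1, h2⟩
      refine ⟨fun π s hπ q hq hs => ?_, fun π s hπ q hq hs => ?_⟩
      · obtain ⟨r, hr, π', s', hπ', hs', h⟩ := h2 π s hπ q hq hs
        exact ⟨r, hr, π', s', hπ', hs', (ih _ (ZFSet.rank_fst_lt_of_pair_mem hπ) rfl).2 h⟩
      · obtain ⟨r, hr, π', s', hπ', hs', h⟩ := h1 π s hπ q hq hs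
        exact ⟨r, hr, π', s', hπ', hs', (ih _ (ZFSet.rank_fst_lt_of_pair_mem hπ') rfl).2 h⟩

theorem ForcesEq.symm {σ τ : ZFSet.{u}} {p : Q.Cond} (h : Q.ForcesEq σ τ p) :
    Q.ForcesEq τ σ p :=
  forcesEq_comm.1 h

theorem forcesMem_of_pair_mem {σ τ : ZFSet.{u}} {s p : Q.Cond} (h : ZFSet.pair σ s.1 ∈ τ)
    (hs : Q.Le s p) : Q.ForcesMem σ τ p :=
  fun q hq => ⟨q, .rfl, σ, s, h, hs.trans hq, .refl _ _⟩

/-- The clauses of `p ⊩ σ = ǎ`, with the quantifiers over the members of `ǎ` made explicit. -/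
theorem forcesEq_check_iff {σ a : ZFSet.{u}} {p : Q.Cond} : Q.ForcesEq σ (Q.check a) p ↔
    (∀ (π : ZFSet.{u}) (s : Q.Cond), ZFSet.pair π s.1 ∈ σ → ∀ q, Q.Le p q → Q.Le s q →
      ∃ r, Q.Le q r ∧ ∃ b ∈ a, Q.ForcesEq π (Q.check b) r) ∧
    (∀ b ∈ a, ∀ q, Q.Le p q → ∃ r, Q.Le q r ∧ ∃ (π : ZFSet.{u}) (s : Q.Cond),
      ZFSet.pair π s.1 ∈ σ ∧ Q.Le s r ∧ Q.ForcesEq π (Q.check b) r) := by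
  rw [ForcesEq]
  refine and_congr ⟨fun h π s hπ q hq hs => ?_, fun h π s hπ q hq hs => ?_⟩
    ⟨fun h b hb q hq => ?_, fun h π' s' hπ' q hq hs => ?_⟩
  · obtain ⟨r, hr, π', s', hπ', -, he⟩ := h π s hπ q hq hs
    obtain ⟨b, hb, rfl, -⟩ := pair_mem_check.1 hπ'
    exact ⟨r, hr, b, hb, he⟩
  · obtain ⟨r, hr, b, hb, he⟩ := h π s hπ q hq hs
    exact ⟨r, hr, Q.check b, Q.botCond, pair_mem_check.2 ⟨b, hb, rfl, rfl⟩, botCond_le _, he⟩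
  · obtain ⟨r, hr, π, s, h1, h2, h3⟩ := h (Q.check b) Q.botCond
      (pair_mem_check.2 ⟨b, hb, rfl, rfl⟩) q hq (botCond_le _)
    exact ⟨r, hr, π, s, h1, h2, h3⟩
  · obtain ⟨b, hb, rfl, -⟩ := pair_mem_check.1 hπ'
    obtain ⟨r, hr, π, s, h1, h2, h3⟩ := h b hb q hq
    exact ⟨r, hr, π, s, h1, h2, h3⟩

/-- A condition forces a name to be equal to at most one set of the ground model. -/
theorem ForcesEq.check_unique {σ a b : ZFSet.{u}} {p : Q.Cond} (ha : Q.ForcesEq σ (Q.check a) p)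
    (hb : Q.ForcesEq σ (Q.check b) p) : a = b := by
  induction hn : σ.rank using Ordinal.lt_wf.induction generalizing σ a b p with
  | _ n ih =>
    subst hn
    have key : ∀ {a b : ZFSet.{u}}, Q.ForcesEq σ (Q.check a) p → Q.ForcesEq σ (Q.check b) p →
        ∀ c ∈ a, c ∈ b := by
      intro a b ha hb c hc
      obtain ⟨r, hr, π, s, hπ, hs, he⟩ := (forcesEq_check_iff.1 ha).2 c hc p .rfl
      obtain ⟨r', hr', d, hd, he'⟩ := (forcesEq_check_iff.1 hb).1 π s hπ r hr hs
      rwa [ih _ (ZFSet.rank_fst_lt_of_pair_mem hπ) (he.mono hr') he' rfl]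
    ext c
    exact ⟨key ha hb c, key hb ha c⟩

theorem ForcesEq.forcesMem_of_mem {σ a b : ZFSet.{u}} {p : Q.Cond}
    (h : Q.ForcesEq σ (Q.check a) p) (hb : b ∈ a) : Q.ForcesMem (Q.check b) σ p := by
  intro q hq
  obtain ⟨r, hr, π, s, hπ, hs, he⟩ := (forcesEq_check_iff.1 h).2 b hb q hq
  exact ⟨r, hr, π, s, hπ, hs, he.symm⟩

theorem ForcesOrdinal.of_forcesMem {σ τ : ZFSet.{u}} {p : Q.Cond} (h : Q.ForcesOrdinal τ p)
    (hσ : Q.IsName σ) (hm : Q.ForcesMem σ τ p) : Q.ForcesOrdinal σ p :=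
  ⟨h.2 σ hσ p .rfl hm, fun x hx q hq hxσ =>
    h.2 x hx q hq (h.1 σ x hσ hx q hq (hm.mono hq) hxσ)⟩

/-- Forcing adds no ordinals: a name which is forced to be an ordinal is forced, densely often, to
be equal to an ordinal of the ground model. -/
theorem ForcesOrdinal.exists_forcesEq_check {τ : ZFSet.{u}} (hτ : Q.IsName τ) {p : Q.Cond}
    (h : Q.ForcesOrdinal τ p) :
    ∃ r, Q.Le p r ∧ ∃ α : Ordinal.{u}, Q.ForcesEq τ (Q.check α.toZFSet) r := by
  induction hn : τ.rank using Ordinal.lt_wf.induction generalizing τ p with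
  | _ n ih =>
    subst hn
    -- `α` is bad if some extension of `p` forces that it is not an element of `τ`
    let bad : Ordinal.{u} → Prop := fun α =>
      ∃ q, Q.Le p q ∧ ∀ r, Q.Le q r → ¬ Q.ForcesMem (Q.check α.toZFSet) τ r
    have hbad : ∃ α, bad α := by
      by_contra hcon
      -- Otherwise every ordinal is the value of a name in the domain of `τ` under some condition,
      -- which would inject the class of ordinals into a set.
      have hval : ∀ α : Ordinal.{u}, ∃ x : Q.carrier × ZFSet.sUnion (ZFSet.sUnion τ),
          ∀ β : Ordinal.{u}, Q.ForcesEq x.2.1 (Q.check β.toZFSet) x.1 ↔ α = β := by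
        intro α
        by_contra hα
        refine hcon ⟨α, p, .rfl, fun r hr hm => hα ?_⟩
        obtain ⟨r', -, π, s, hπ, -, he⟩ := hm r .rfl
        refine ⟨⟨r', π, ?_⟩, fun β => ⟨fun hβ => ?_, fun hβ => hβ ▸ he.symm⟩⟩
        · exact ZFSet.mem_sUnion_of_mem (z := {π}) (by simp)
            (ZFSet.mem_sUnion_of_mem (by simp [ZFSet.pair]) hπ)
        · exact Ordinal.toZFSet_injective (he.symm.check_unique hβ)
      choose g hg using hval
      have hinj : Function.Injective g := fun α β hαβ => by
        have h1 := (hg β β).2 rfl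
        rw [← hαβ] at h1
        exact (hg α β).1 h1
      exact not_small_ordinal.{u} (small_of_injective hinj)
    -- For the least bad `α`, a witness `q` forces `τ` to be equal to `α`.
    obtain ⟨α, ⟨q, hpq, hq⟩, hmin⟩ := WellFounded.has_min Ordinal.lt_wf {α | bad α} hbad
    refine ⟨q, hpq, α, forcesEq_check_iff.2 ⟨fun π s hπ r hr hs => ?_, fun b hb r hr => ?_⟩⟩
    · have hr' := hpq.trans hr
      have hmem : Q.ForcesMem π τ r := forcesMem_of_pair_mem hπ hs
      have hπn := hτ.of_pair_mem hπ
      obtain ⟨r', hrr', β, hβ⟩ := ih _ (ZFSet.rank_fst_lt_of_pair_mem hπ) hπn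
        ((h.mono hr').of_forcesMem hπn hmem) rfl
      refine ⟨r', hrr', _, ?_, hβ⟩
      rw [Ordinal.toZFSet_mem_toZFSet_iff]
      by_contra hlt
      refine hq r' (hr.trans hrr') ?_
      rcases (not_lt.1 hlt).eq_or_lt with rfl | hlt
      · exact fun r₁ hr₁ => ⟨r₁, .rfl, π, s, hπ, (hs.trans hrr').trans hr₁, (hβ.mono hr₁).symm⟩
      · exact h.1 π _ hπn (isName_check _) r' (hr'.trans hrr') (hmem.mono hrr')
          (hβ.forcesMem_of_mem (Ordinal.toZFSet_mem_toZFSet_iff.2 hlt))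
    · obtain ⟨β, hβ, rfl⟩ := Ordinal.mem_toZFSet_iff.1 hb
      have hnb : ¬ bad β := fun hb => hmin β hb hβ
      simp only [bad, not_exists, not_and, not_forall, not_not] at hnb
      obtain ⟨r', hr', hm⟩ := hnb r (hpq.trans hr)
      obtain ⟨r₁, hr₁, π, s, hπ, hs, he⟩ := hm r' .rfl
      exact ⟨r₁, hr'.trans hr₁, π, s, hπ, hs, he.symm⟩

end ForcingNotion

/-! ### Sets of hereditarily small size -/

section HSet

variable {χ : Cardinal.{u}}

theorem mem_hSet_iff {x : ZFSet.{u}} : x ∈ HSet χ ↔ x.card < χ ∧ ∀ y ∈ x, y ∈ HSet χ :=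
  ZFSet.hereditarily_iff

theorem HSet.mem {x y : ZFSet.{u}} (hx : x ∈ HSet χ) (hy : y ∈ x) : y ∈ HSet χ :=
  (mem_hSet_iff.1 hx).2 y hy

theorem HSet.of_subset {x y : ZFSet.{u}} (hx : x ∈ HSet χ) (hy : y ⊆ x) : y ∈ HSet χ :=
  mem_hSet_iff.2 ⟨(ZFSet.card_mono hy).trans_lt (mem_hSet_iff.1 hx).1,
    fun _ hz => HSet.mem hx (hy hz)⟩

theorem HSet.upair (hχ : ℵ₀ ≤ χ) {x y : ZFSet.{u}} (hx : x ∈ HSet χ) (hy : y ∈ HSet χ) :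
    ({x, y} : ZFSet.{u}) ∈ HSet χ := by
  refine mem_hSet_iff.2 ⟨?_, fun z hz => ?_⟩
  · refine (ZFSet.card_insert_le.trans ?_).trans_lt ((natCast_lt_aleph0 (n := 2)).trans_le hχ)
    rw [ZFSet.card_singleton, one_add_one_eq_two, Nat.cast_ofNat]
  · rcases ZFSet.mem_pair.1 hz with rfl | rfl <;> assumption

theorem HSet.singleton (hχ : ℵ₀ ≤ χ) {x : ZFSet.{u}} (hx : x ∈ HSet χ) :
    ({x} : ZFSet.{u}) ∈ HSet χ := by
  rw [← ZFSet.pair_eq_singleton]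
  exact HSet.upair hχ hx hx

theorem HSet.pair (hχ : ℵ₀ ≤ χ) {x y : ZFSet.{u}} (hx : x ∈ HSet χ) (hy : y ∈ HSet χ) :
    ZFSet.pair x y ∈ HSet χ :=
  HSet.upair hχ (HSet.singleton hχ hx) (HSet.upair hχ hx hy)

theorem HSet.of_pair {x y : ZFSet.{u}} (h : ZFSet.pair x y ∈ HSet χ) :
    x ∈ HSet χ ∧ y ∈ HSet χ := by
  have h1 : ({x, y} : ZFSet.{u}) ∈ HSet χ := HSet.mem h (by simp [ZFSet.pair])
  exact ⟨HSet.mem h1 (by simp), HSet.mem h1 (by simp)⟩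

theorem HSet.of_pair_mem {x y z : ZFSet.{u}} (hz : z ∈ HSet χ) (h : ZFSet.pair x y ∈ z) :
    x ∈ HSet χ ∧ y ∈ HSet χ :=
  HSet.of_pair (HSet.mem hz h)

/-- For regular `χ`, the transitive closure of an element of `H(χ)` has size less than `χ`. -/
theorem HSet.exists_isTransitive (hχ : χ.IsRegular) {x : ZFSet.{u}} (hx : x ∈ HSet χ) :
    ∃ T ∈ HSet χ, x ∈ T ∧ T.IsTransitive := by
  induction x using ZFSet.inductionOn with
  | _ x ih =>
    choose! T hT hxT htr using fun y hy => ih y hy (HSet.mem hx hy)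
    let U : ZFSet.{u} := ZFSet.iUnion fun i : Shrink.{u} x => T ((equivShrink x).symm i).1
    have hU : ∀ z, z ∈ U ↔ ∃ y ∈ x, z ∈ T y := by
      intro z
      rw [ZFSet.mem_iUnion]
      constructor
      · rintro ⟨i, hi⟩
        exact ⟨_, ((equivShrink x).symm i).2, hi⟩
      · rintro ⟨y, hy, hz⟩
        exact ⟨equivShrink x ⟨y, hy⟩, by simpa using hz⟩
    refine ⟨insert x U, mem_hSet_iff.2 ⟨?_, fun z hz => ?_⟩, ZFSet.mem_insert _ _,
      fun z hz w hw => ?_⟩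
    · refine ZFSet.card_insert_le.trans_lt (add_lt_of_lt hχ.aleph0_le ?_
        (one_lt_aleph0.trans_le hχ.aleph0_le))
      have h1 := ZFSet.lift_card_iUnion_le_sum_card
        (f := fun i : Shrink.{u} x => T ((equivShrink x).symm i).1)
      rw [Cardinal.lift_id] at h1
      refine h1.trans_lt (sum_lt_of_isRegular hχ (mem_hSet_iff.1 hx).1 fun i => ?_)
      exact (mem_hSet_iff.1 (hT _ ((equivShrink x).symm i).2)).1
    · rcases ZFSet.mem_insert_iff.1 hz with rfl | hz
      · exact hx
      · obtain ⟨y, hy, hzy⟩ := (hU z).1 hz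
        exact HSet.mem (hT y hy) hzy
    · refine ZFSet.mem_insert_of_mem _ ((hU w).2 ?_)
      rcases ZFSet.mem_insert_iff.1 hz with rfl | hz
      · exact ⟨w, hw, hxT w hw⟩
      · obtain ⟨y, hy, hzy⟩ := (hU z).1 hz
        exact ⟨y, hy, htr y hy z hzy hw⟩

/-- Every set belongs to `H(χ)` for all sufficiently large `χ`. -/
theorem exists_forall_mem_hSet (x : ZFSet.{u}) :
    ∃ χ₀ : Cardinal.{u}, ∀ χ, χ₀ ≤ χ → x ∈ HSet χ := by
  induction x using ZFSet.inductionOn with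
  | _ x ih =>
    choose! c hc using ih
    let s : Cardinal.{u} := ⨆ i : Shrink.{u} x, c ((equivShrink x).symm i).1
    refine ⟨max (Order.succ x.card) s, fun χ hχ => mem_hSet_iff.2 ⟨?_, fun y hy => ?_⟩⟩
    · exact (Order.lt_succ _).trans_le ((le_max_left _ _).trans hχ)
    · refine hc y hy χ (le_trans ?_ ((le_max_right _ _).trans hχ))
      have := le_ciSup (f := fun i : Shrink.{u} x => c ((equivShrink x).symm i).1)
        Cardinal.bddAbove_of_small (equivShrink x ⟨y, hy⟩)
      simpa using this

end HSet

/-! ### Definability over `(H(χ), ∈, <*)` -/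

section Definability

variable {χ : Cardinal.{u}}

/-- The relation `φ` on `H(χ)`, whose arguments are indexed by `α`, is definable without parameters
in `(H(χ), ∈, W)`. A quantifier is handled by passing from `α` to `Option α`, the new argument
being `none`. -/
def DefinableRel (W : HSet χ → HSet χ → Prop) {α : Type} (φ : (α → HSet χ) → Prop) : Prop :=
  letI := hStructure χ W
  ∃ F : hLang.Formula α, ∀ v, F.Realize v ↔ φ v

/-- `⟨x, y⟩ ∈ z`, for elements of `H(χ)`. -/
def PairMem (z x y : HSet χ) : Prop := ZFSet.pair x.1 y.1 ∈ z.1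

/-- `⟨x, ⟨y, w⟩⟩ ∈ z`, for elements of `H(χ)`. -/
def TripleMem (z x y w : HSet χ) : Prop := ZFSet.pair x.1 (ZFSet.pair y.1 w.1) ∈ z.1

namespace DefinableRel

variable {W : HSet χ → HSet χ → Prop} {α : Type} {φ ψ : (α → HSet χ) → Prop}

theorem mem (i j : α) : DefinableRel W fun v => (v i).1 ∈ (v j).1 := by
  let _ := hStructure χ W
  let r : hLang.Relations 2 := HRel.mem
  exact ⟨r.formula₂ (.var i) (.var j), fun v => FirstOrder.Language.Formula.realize_rel₂⟩

theorem eq (i j : α) : DefinableRel W fun v => v i = v j := by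
  let _ := hStructure χ W
  refine ⟨FirstOrder.Language.Term.equal (L := hLang) (.var i) (.var j), fun v => ?_⟩
  rw [FirstOrder.Language.Formula.realize_equal]
  exact Iff.rfl

theorem not (h : DefinableRel W φ) : DefinableRel W fun v => ¬ φ v := by
  let _ := hStructure χ W
  obtain ⟨F, hF⟩ := h
  exact ⟨F.not, fun v => by rw [FirstOrder.Language.Formula.realize_not, hF]⟩

theorem and (h : DefinableRel W φ) (h' : DefinableRel W ψ) :
    DefinableRel W fun v => φ v ∧ ψ v := by
  let _ := hStructure χ W
  obtain ⟨F, hF⟩ := h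
  obtain ⟨G, hG⟩ := h'
  exact ⟨F ⊓ G, fun v => by rw [FirstOrder.Language.Formula.realize_inf, hF, hG]⟩

theorem congr (h : DefinableRel W φ) (h' : ∀ v, φ v ↔ ψ v) : DefinableRel W ψ := by
  rwa [show ψ = φ from funext fun v => propext (h' v).symm]

theorem imp (h : DefinableRel W φ) (h' : DefinableRel W ψ) :
    DefinableRel W fun v => φ v → ψ v :=
  (h.and h'.not).not.congr fun v => by tauto

theorem or (h : DefinableRel W φ) (h' : DefinableRel W ψ) :
    DefinableRel W fun v => φ v ∨ ψ v :=
  (h.not.and h'.not).not.congr fun v => by tauto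

theorem iff (h : DefinableRel W φ) (h' : DefinableRel W ψ) :
    DefinableRel W fun v => (φ v ↔ ψ v) :=
  ((h.imp h').and (h'.imp h)).congr fun v => by tauto

theorem ex {R : (α → HSet χ) → HSet χ → Prop}
    (h : DefinableRel W fun w : Option α → HSet χ => R (fun i => w (some i)) (w none)) :
    DefinableRel W fun v => ∃ a, R v a := by
  let _ := hStructure χ W
  obtain ⟨F, hF⟩ := h
  refine ⟨(F.relabel (fun o : Option α => o.elim (Sum.inr ()) Sum.inl)).iExs Unit, fun v => ?_⟩
  rw [FirstOrder.Language.Formula.realize_iExs]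
  simp only [FirstOrder.Language.Formula.realize_relabel, hF]
  exact ⟨fun ⟨i, hi⟩ => ⟨i (), hi⟩, fun ⟨a, ha⟩ => ⟨fun _ => a, ha⟩⟩

theorem all {R : (α → HSet χ) → HSet χ → Prop}
    (h : DefinableRel W fun w : Option α → HSet χ => R (fun i => w (some i)) (w none)) :
    DefinableRel W fun v => ∀ a, R v a :=
  (ex (R := fun v a => ¬ R v a) h.not).not.congr fun v => by simp

theorem eq_upair (i j k : α) :
    DefinableRel W fun v => (v i).1 = {(v j).1, (v k).1} := by
  refine congr (φ := fun v => ∀ a : HSet χ, a.1 ∈ (v i).1 ↔ (a = v j ∨ a = v k)) ?_ fun v => ?_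
  · exact all ((mem _ _).iff ((eq _ _).or (eq _ _)))
  · simp only [Subtype.ext_iff]
    constructor
    · intro h
      ext z
      rw [ZFSet.mem_pair]
      refine ⟨fun hz => (h ⟨z, HSet.mem (v i).2 hz⟩).1 hz, fun hz => ?_⟩
      rcases hz with rfl | rfl
      · exact (h (v j)).2 (Or.inl rfl)
      · exact (h (v k)).2 (Or.inr rfl)
    · intro h a
      rw [h, ZFSet.mem_pair]

theorem eq_pair (hχ : ℵ₀ ≤ χ) (i j k : α) :
    DefinableRel W fun v => (v i).1 = ZFSet.pair (v j).1 (v k).1 := by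
  refine congr (φ := fun v => ∃ a : HSet χ, ∃ b : HSet χ,
    a.1 = {(v j).1, (v j).1} ∧ b.1 = {(v j).1, (v k).1} ∧ (v i).1 = {a.1, b.1}) ?_ fun v => ?_
  · exact ex (ex ((eq_upair _ _ _).and ((eq_upair _ _ _).and (eq_upair _ _ _))))
  · constructor
    · rintro ⟨a, b, ha, hb, h⟩
      rw [h, ha, hb, ZFSet.pair_eq_singleton, ZFSet.pair]
    · intro h
      exact ⟨⟨_, HSet.upair hχ (v j).2 (v j).2⟩, ⟨_, HSet.upair hχ (v j).2 (v k).2⟩, rfl, rfl,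
        h.trans (by simp [ZFSet.pair])⟩

theorem pairMem (hχ : ℵ₀ ≤ χ) (i j k : α) :
    DefinableRel W fun v => PairMem (v i) (v j) (v k) := by
  refine congr (φ := fun v => ∃ a : HSet χ, a.1 = ZFSet.pair (v j).1 (v k).1 ∧ a.1 ∈ (v i).1)
    ?_ fun v => ?_
  · exact ex ((eq_pair hχ _ _ _).and (mem _ _))
  · constructor
    · rintro ⟨a, ha, h⟩
      rwa [ha] at h
    · exact fun h => ⟨⟨_, HSet.mem (v i).2 h⟩, rfl, h⟩

theorem tripleMem (hχ : ℵ₀ ≤ χ) (i j k l : α) :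
    DefinableRel W fun v => TripleMem (v i) (v j) (v k) (v l) := by
  refine congr (φ := fun v => ∃ a : HSet χ, a.1 = ZFSet.pair (v k).1 (v l).1 ∧
    PairMem (v i) (v j) a) ?_ fun v => ?_
  · exact ex ((eq_pair hχ _ _ _).and (pairMem hχ _ _ _))
  · constructor
    · rintro ⟨a, ha, h⟩
      rw [PairMem, ha] at h
      exact h
    · exact fun h => ⟨⟨_, (HSet.of_pair_mem (v i).2 h).2⟩, rfl, h⟩

end DefinableRel

/-- Existential statements with parameters in an elementary submodel have witnesses in it. -/
theorem IsElementarySubmodel.exists_mem {W : HSet χ → HSet χ → Prop} {N : ZFSet.{u}}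
    (hN : IsElementarySubmodel χ W N) {α : Type} {R : (α → HSet χ) → HSet χ → Prop}
    (hR : DefinableRel W fun w : Option α → HSet χ => R (fun i => w (some i)) (w none))
    (v : α → HSet χ) (hv : ∀ i, (v i).1 ∈ N) (h : ∃ y, R v y) : ∃ y, y.1 ∈ N ∧ R v y := by
  let _ := hStructure χ W
  obtain ⟨M, hM⟩ := hN
  have hv' : ∀ i, v i ∈ M := fun i => by
    obtain ⟨_, hi⟩ := (hM _).1 (hv i)
    exact hi
  obtain ⟨F, hF⟩ := hR
  let G := (F.relabel (fun o : Option α => o.elim (Sum.inr ()) Sum.inl)).iExs Unit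
  obtain ⟨y, hy⟩ := h
  let v' : α → M := fun i => ⟨v i, hv' i⟩
  have h1 : G.Realize (M.subtype ∘ v') := by
    rw [FirstOrder.Language.Formula.realize_iExs]
    refine ⟨fun _ => y, ?_⟩
    rw [FirstOrder.Language.Formula.realize_relabel, hF]
    exact hy
  rw [M.subtype.map_formula, FirstOrder.Language.Formula.realize_iExs] at h1
  obtain ⟨i, hi⟩ := h1
  rw [FirstOrder.Language.Formula.realize_relabel, ← M.subtype.map_formula, hF] at hi
  exact ⟨i (), (hM _).2 ⟨(i ()).1.2, (i ()).2⟩, hi⟩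

end Definability

/-! ### Deciding names in elementary submodels -/

section Decision

variable {χ : Cardinal.{u}}

/-- `E` is a set of triples `⟨σ, ⟨s, a⟩⟩` which is closed under unfolding the clauses of
`s ⊩ σ = ǎ`, the order of the forcing being `R`. As `∈` is well-founded, all triples in such a set
are correct; in contrast to the forcing relation itself, the property is plainly first-order. -/
def IsDecisionSystem (R E : HSet χ) : Prop :=
  ∀ σ s a : HSet χ, TripleMem E σ s a →
    (∀ π t q : HSet χ, PairMem σ π t → PairMem R s q → PairMem R t q →
      ∃ r b : HSet χ, PairMem R q r ∧ b.1 ∈ a.1 ∧ TripleMem E π r b) ∧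
    (∀ b q : HSet χ, b.1 ∈ a.1 → PairMem R s q →
      ∃ r π t : HSet χ, PairMem R q r ∧ PairMem σ π t ∧ PairMem R t r ∧ TripleMem E π r b)

theorem definableRel_isDecisionSystem (hχ : ℵ₀ ≤ χ) {W : HSet χ → HSet χ → Prop} {α : Type}
    (i j : α) : DefinableRel W fun v => IsDecisionSystem (v i) (v j) := by
  unfold IsDecisionSystem
  open DefinableRel in
  refine all (all (all (imp (tripleMem hχ _ _ _ _) (and ?_ ?_))))
  · open DefinableRel in
    exact all (all (all (imp (pairMem hχ _ _ _) (imp (pairMem hχ _ _ _) (imp (pairMem hχ _ _ _)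
      (ex (ex (and (pairMem hχ _ _ _) (and (mem _ _) (tripleMem hχ _ _ _ _))))))))))
  · open DefinableRel in
    exact all (all (imp (mem _ _) (imp (pairMem hχ _ _ _) (ex (ex (ex (and (pairMem hχ _ _ _)
      (and (pairMem hχ _ _ _) (and (pairMem hχ _ _ _) (tripleMem hχ _ _ _ _))))))))))

namespace ForcingNotion

variable {Q : ForcingNotion.{u}}

theorem mem_of_pair_mem_rel {p q : ZFSet.{u}} (h : ZFSet.pair p q ∈ Q.rel) :
    p ∈ Q.carrier ∧ q ∈ Q.carrier :=
  ZFSet.pair_mem_prod.1 (Q.rel_subset h)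

theorem forcesEq_of_isDecisionSystem {R E : HSet χ} (hR : R.1 = Q.rel)
    (hE : IsDecisionSystem R E) {σ a : ZFSet.{u}} {s : Q.Cond}
    (h : ZFSet.pair σ (ZFSet.pair s.1 a) ∈ E.1) : Q.ForcesEq σ (Q.check a) s := by
  induction hn : σ.rank using Ordinal.lt_wf.induction generalizing σ a s with
  | _ n ih =>
    subst hn
    have hmem : σ ∈ HSet χ ∧ ZFSet.pair s.1 a ∈ HSet χ := HSet.of_pair_mem E.2 h
    have hs := (HSet.of_pair hmem.2).1
    have ha := (HSet.of_pair hmem.2).2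
    have hrel : ∀ {x y : ZFSet.{u}}, ZFSet.pair x y ∈ Q.rel → x ∈ HSet χ ∧ y ∈ HSet χ :=
      fun hxy => HSet.of_pair_mem R.2 (hR ▸ hxy)
    obtain ⟨h1, h2⟩ := hE ⟨σ, hmem.1⟩ ⟨s.1, hs⟩ ⟨a, ha⟩ h
    simp only [PairMem, TripleMem, hR] at h1 h2
    rw [forcesEq_check_iff]
    refine ⟨fun π t hπ q hq htq => ?_, fun b hb q hq => ?_⟩
    · obtain ⟨hπH, htH⟩ := HSet.of_pair_mem hmem.1 hπ
      obtain ⟨r, b, hr, hb, he⟩ := h1 ⟨π, hπH⟩ ⟨t.1, htH⟩ ⟨q.1, (hrel hq).2⟩ hπ hq htq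
      exact ⟨⟨r.1, (mem_of_pair_mem_rel hr).2⟩, hr, b.1, hb,
        ih _ (ZFSet.rank_fst_lt_of_pair_mem hπ) he rfl⟩
    · obtain ⟨r, π, t, hr, hπ, ht, he⟩ := h2 ⟨b, HSet.mem ha hb⟩ ⟨q.1, (hrel hq).2⟩ hb hq
      exact ⟨⟨r.1, (mem_of_pair_mem_rel hr).2⟩, hr, π.1, ⟨t.1, (mem_of_pair_mem_rel ht).1⟩,
        hπ, ht, ih _ (ZFSet.rank_fst_lt_of_pair_mem hπ) he rfl⟩

/-- The values of names in `H(χ)` are in `H(χ)`: a member `b` of a value of `σ` is determined by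
a pair in `σ` and a condition forcing the name in this pair to be equal to `b`. -/
theorem ForcesEq.mem_hSet (hχ : ℵ₀ ≤ χ) (hC : Q.carrier.card < χ) {σ a : ZFSet.{u}} {s : Q.Cond}
    (hσ : σ ∈ HSet χ) (h : Q.ForcesEq σ (Q.check a) s) : a ∈ HSet χ := by
  induction hn : σ.rank using Ordinal.lt_wf.induction generalizing σ a s with
  | _ n ih =>
    subst hn
    have key : ∀ b : a, ∃ (x : σ × Q.carrier) (π : ZFSet.{u}) (t : Q.Cond),
        x.1.1 = ZFSet.pair π t.1 ∧ Q.ForcesEq π (Q.check b.1) x.2 := by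
      rintro ⟨b, hb⟩
      obtain ⟨r, -, π, t, hπ, -, he⟩ := (forcesEq_check_iff.1 h).2 b hb s .rfl
      exact ⟨⟨⟨_, hπ⟩, r⟩, π, t, rfl, he⟩
    choose g π t hg he using key
    have hinj : Function.Injective g := by
      intro b c hbc
      have h1 := hg b
      rw [hbc, hg c] at h1
      have h2 := he b
      rw [hbc, ← (ZFSet.pair_injective h1).1] at h2
      exact Subtype.ext (h2.check_unique (he c))
    refine mem_hSet_iff.2 ⟨?_, fun b hb => ?_⟩
    · have h1 := Cardinal.mk_le_of_injective hinj
      rw [Cardinal.mk_prod, Cardinal.lift_id, Cardinal.lift_id, ZFSet.cardinalMk_coe_sort,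
        ZFSet.cardinalMk_coe_sort, ZFSet.cardinalMk_coe_sort, ← Cardinal.lift_mul,
        Cardinal.lift_le] at h1
      exact h1.trans_lt (mul_lt_of_lt hχ (mem_hSet_iff.1 hσ).1 hC)
    · have hx := (g ⟨b, hb⟩).1.2
      rw [hg] at hx
      exact ih _ (ZFSet.rank_fst_lt_of_pair_mem hx) (HSet.of_pair_mem hσ hx).1 (he ⟨b, hb⟩) rfl

/-- The forcing relation `s ⊩ σ = ǎ`, for `σ` in a transitive set containing `τ`, is a decision
system in `H(χ)`. -/
theorem exists_isDecisionSystem (hχ : χ.IsRegular) (hC : Q.carrier ∈ HSet χ) {R : HSet χ}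
    (hR : R.1 = Q.rel) {τ : ZFSet.{u}} (hτ : τ ∈ HSet χ) :
    ∃ E : HSet χ, IsDecisionSystem R E ∧ ∀ (s : Q.Cond) (a : ZFSet.{u}),
      Q.ForcesEq τ (Q.check a) s → ZFSet.pair τ (ZFSet.pair s.1 a) ∈ E.1 := by
  obtain ⟨T, hT, hτT, htr⟩ := HSet.exists_isTransitive hχ hτ
  let I : Type (u + 1) := {x : T × Q.carrier // ∃ a, Q.ForcesEq x.1.1 (Q.check a) x.2}
  choose v hv using fun x : I => x.2
  let E : ZFSet.{u} := ZFSet.range fun x : I =>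
    ZFSet.pair x.1.1.1 (ZFSet.pair x.1.2.1 (v x))
  have hE : ∀ σ s a : ZFSet.{u}, ZFSet.pair σ (ZFSet.pair s a) ∈ E ↔
      σ ∈ T ∧ ∃ hs : s ∈ Q.carrier, Q.ForcesEq σ (Q.check a) ⟨s, hs⟩ := by
    intro σ s a
    rw [ZFSet.mem_range]
    constructor
    · rintro ⟨x, hx⟩
      obtain ⟨rfl, hx2⟩ := ZFSet.pair_injective hx
      obtain ⟨rfl, rfl⟩ := ZFSet.pair_injective hx2
      exact ⟨x.1.1.2, x.1.2.2, hv x⟩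
    · rintro ⟨hσ, hs, h⟩
      refine ⟨⟨(⟨σ, hσ⟩, ⟨s, hs⟩), a, h⟩, ?_⟩
      rw [(hv ⟨(⟨σ, hσ⟩, ⟨s, hs⟩), a, h⟩).check_unique h]
  have hEH : E ∈ HSet χ := by
    refine mem_hSet_iff.2 ⟨?_, fun z hz => ?_⟩
    · have h1 := ZFSet.lift_card_range_le (f := fun x : I =>
        ZFSet.pair x.1.1.1 (ZFSet.pair x.1.2.1 (v x)))
      have h2 : #I ≤ #(T × Q.carrier) := Cardinal.mk_subtype_le _
      rw [Cardinal.mk_prod, Cardinal.lift_id, Cardinal.lift_id, ZFSet.cardinalMk_coe_sort,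
        ZFSet.cardinalMk_coe_sort, ← Cardinal.lift_mul] at h2
      rw [Cardinal.lift_id'.{u, u + 1}] at h1
      exact (Cardinal.lift_le.1 (h1.trans h2)).trans_lt
        (mul_lt_of_lt hχ.aleph0_le (mem_hSet_iff.1 hT).1 (mem_hSet_iff.1 hC).1)
    · obtain ⟨x, rfl⟩ := ZFSet.mem_range.1 hz
      have hσ := HSet.mem hT x.1.1.2
      exact HSet.pair hχ.aleph0_le hσ (HSet.pair hχ.aleph0_le (HSet.mem hC x.1.2.2)
        ((hv x).mem_hSet hχ.aleph0_le (mem_hSet_iff.1 hC).1 hσ))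
  refine ⟨⟨E, hEH⟩, fun σ s a h => ?_, fun s a h => (hE _ _ _).2 ⟨hτT, s.2, h⟩⟩
  obtain ⟨hσT, hs, h⟩ := (hE _ _ _).1 h
  rw [forcesEq_check_iff] at h
  have hT' : ∀ {π t : ZFSet.{u}}, ZFSet.pair π t ∈ σ.1 → π ∈ T := fun {π t} hπ =>
    htr _ (htr _ (htr _ hσT hπ) (show {π} ∈ ZFSet.pair π t by simp [ZFSet.pair])) (by simp)
  have hval : ∀ {π b : ZFSet.{u}} {r : Q.Cond}, π ∈ T → Q.ForcesEq π (Q.check b) r →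
      b ∈ HSet χ :=
    fun hπ he => he.mem_hSet hχ.aleph0_le (mem_hSet_iff.1 hC).1 (HSet.mem hT hπ)
  refine ⟨fun π t q hπ hq ht => ?_, fun b q hb hq => ?_⟩
  · rw [PairMem, hR] at hq ht
    obtain ⟨r, hr, b, hb, he⟩ := h.1 π.1 ⟨t.1, (mem_of_pair_mem_rel ht).1⟩ hπ
      ⟨q.1, (mem_of_pair_mem_rel hq).2⟩ hq ht
    exact ⟨⟨r.1, HSet.mem hC r.2⟩, ⟨b, HSet.mem a.2 hb⟩, by rw [PairMem, hR]; exact hr, hb,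
      (hE _ _ _).2 ⟨hT' hπ, r.2, he⟩⟩
  · rw [PairMem, hR] at hq
    obtain ⟨r, hr, π, t, hπ, ht, he⟩ := h.2 b.1 hb ⟨q.1, (mem_of_pair_mem_rel hq).2⟩ hq
    exact ⟨⟨r.1, HSet.mem hC r.2⟩, ⟨π, HSet.mem hT (hT' hπ)⟩, ⟨t.1, HSet.mem hC t.2⟩,
      by rw [PairMem, hR]; exact hr, hπ, by rw [PairMem, hR]; exact ht,
      (hE _ _ _).2 ⟨hT' hπ, r.2, he⟩⟩

end ForcingNotion

end Decision

section Submodel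

variable {χ : Cardinal.{u}} {W : HSet χ → HSet χ → Prop} {N : ZFSet.{u}}

theorem IsElementarySubmodel.mem_hSet (hN : IsElementarySubmodel χ W N) {x : ZFSet.{u}}
    (hx : x ∈ N) : x ∈ HSet χ := by
  obtain ⟨M, hM⟩ := hN
  exact ((hM x).1 hx).1

theorem IsElementarySubmodel.fst_mem (hN : IsElementarySubmodel χ W N) (hχ : ℵ₀ ≤ χ)
    {x y : ZFSet.{u}} (h : ZFSet.pair x y ∈ N) : x ∈ N := by
  have hH := hN.mem_hSet h
  obtain ⟨a, haN, b, hab⟩ := hN.exists_mem (α := Unit)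
    (R := fun v a => ∃ b : HSet χ, (v ()).1 = ZFSet.pair a.1 b.1)
    (.ex (.eq_pair hχ _ _ _)) (fun _ => ⟨_, hH⟩) (fun _ => h)
    ⟨⟨x, (HSet.of_pair hH).1⟩, ⟨y, (HSet.of_pair hH).2⟩, rfl⟩
  rwa [(ZFSet.pair_injective hab).1]

theorem IsElementarySubmodel.snd_mem (hN : IsElementarySubmodel χ W N) (hχ : ℵ₀ ≤ χ)
    {x y : ZFSet.{u}} (h : ZFSet.pair x y ∈ N) : y ∈ N := by
  have hH := hN.mem_hSet h
  obtain ⟨a, haN, b, hab⟩ := hN.exists_mem (α := Unit)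
    (R := fun v a => ∃ b : HSet χ, (v ()).1 = ZFSet.pair b.1 a.1)
    (.ex (.eq_pair hχ _ _ _)) (fun _ => ⟨_, hH⟩) (fun _ => h)
    ⟨⟨y, (HSet.of_pair hH).2⟩, ⟨x, (HSet.of_pair hH).1⟩, rfl⟩
  rwa [(ZFSet.pair_injective hab).2]

/-- `N` is closed under the application of set functions that belong to `N`. -/
theorem IsElementarySubmodel.apply_mem (hN : IsElementarySubmodel χ W N) (hχ : ℵ₀ ≤ χ)
    {x k y : ZFSet.{u}} (hx : x ∈ N) (hk : k ∈ N) (hy : ZFSet.pair k y ∈ x)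
    (huniq : ∀ z, ZFSet.pair k z ∈ x → z = y) : y ∈ N := by
  have hxH := hN.mem_hSet hx
  obtain ⟨z, hzN, hz⟩ := hN.exists_mem (α := Fin 2) (R := fun v a => PairMem (v 0) (v 1) a)
    (.pairMem hχ _ _ _) ![⟨x, hxH⟩, ⟨k, hN.mem_hSet hk⟩]
    (fun i => by fin_cases i <;> assumption) ⟨⟨y, (HSet.of_pair_mem hxH hy).2⟩, hy⟩
  rwa [← huniq z.1 hz]

/-- To a name for an ordinal in `N` belongs an upward closed dense set in `N`, whose members in `N`
force the name to be equal to a set in `N`. -/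
theorem ForcingNotion.IsOrdinalName.exists_dense_mem {Q : ForcingNotion.{u}} (hχ : χ.IsRegular)
    (hN : IsElementarySubmodel χ W N) (hQ : Q.toSet ∈ N) {τ : ZFSet.{u}} (hτN : τ ∈ N)
    (hτ : Q.IsOrdinalName τ) :
    ∃ D ∈ N, D ⊆ Q.carrier ∧ (∀ p q : Q.Cond, p.1 ∈ D → Q.Le p q → q.1 ∈ D) ∧
      (∀ p : Q.Cond, ∃ q, Q.Le p q ∧ q.1 ∈ D) ∧
      ∀ p : Q.Cond, p.1 ∈ D → p.1 ∈ N → ∃ a ∈ N, Q.ForcesEq τ (Q.check a) p := by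
  have hω := hχ.aleph0_le
  have hCN : Q.carrier ∈ N := hN.fst_mem hω hQ
  have hRN : Q.rel ∈ N := hN.snd_mem hω hQ
  let C : HSet χ := ⟨_, hN.mem_hSet hCN⟩
  let R : HSet χ := ⟨_, hN.mem_hSet hRN⟩
  let t : HSet χ := ⟨_, hN.mem_hSet hτN⟩
  -- a decision system for `τ` in `N`
  obtain ⟨E, hEN, hE, hdense⟩ := hN.exists_mem (α := Fin 3)
    (R := fun v E => IsDecisionSystem (v 0) E ∧ ∀ s : HSet χ, s.1 ∈ (v 2).1 →
      ∃ r a : HSet χ, PairMem (v 0) s r ∧ TripleMem E (v 1) r a)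
    (.and (definableRel_isDecisionSystem hω _ _) (.all (.imp (.mem _ _)
      (.ex (.ex (.and (.pairMem hω _ _ _) (.tripleMem hω _ _ _ _)))))))
    ![R, t, C] (fun i => by fin_cases i <;> assumption) (by
      obtain ⟨E, hE, hE'⟩ := Q.exists_isDecisionSystem hχ C.2 (R := R) rfl t.2
      refine ⟨E, hE, fun s hs => ?_⟩
      obtain ⟨r, hr, α, hα⟩ := (hτ.2 ⟨s.1, hs⟩).exists_forcesEq_check hτ.1
      exact ⟨⟨r.1, HSet.mem C.2 r.2⟩, ⟨_, hα.mem_hSet hω (mem_hSet_iff.1 C.2).1 t.2⟩, hr,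
        hE' _ _ hα⟩)
  change ∀ s : HSet χ, s.1 ∈ Q.carrier →
      ∃ r a : HSet χ, PairMem R s r ∧ TripleMem E t r a at hdense
  -- the set of all conditions above a decided one
  let D₀ : ZFSet.{u} := Q.carrier.sep fun s =>
    ∃ r a : HSet χ, ZFSet.pair r.1 s ∈ Q.rel ∧ TripleMem E t r a
  have hD₀ : ∀ s, s ∈ D₀ ↔ (s ∈ Q.carrier ∧
      ∃ r a : HSet χ, ZFSet.pair r.1 s ∈ Q.rel ∧ TripleMem E t r a) := fun s => ZFSet.mem_sep
  obtain ⟨D, hDN, hD⟩ := hN.exists_mem (α := Fin 4)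
    (R := fun v D => ∀ s : HSet χ, s.1 ∈ D.1 ↔ (s.1 ∈ (v 0).1 ∧
      ∃ r a : HSet χ, PairMem (v 1) r s ∧ TripleMem (v 3) (v 2) r a))
    (.all (.iff (.mem _ _) (.and (.mem _ _) (.ex (.ex (.and (.pairMem hω _ _ _)
      (.tripleMem hω _ _ _ _)))))))
    ![C, R, t, E] (fun i => by fin_cases i <;> assumption)
    ⟨⟨D₀, HSet.of_subset C.2 ZFSet.sep_subset⟩, fun s => hD₀ s.1⟩
  change ∀ s : HSet χ, s.1 ∈ D.1 ↔ (s.1 ∈ Q.carrier ∧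
      ∃ r a : HSet χ, PairMem R r s ∧ TripleMem E t r a) at hD
  have hcond : ∀ p : Q.Cond, p.1 ∈ HSet χ := fun p => HSet.mem C.2 p.2
  refine ⟨D, hDN, fun s hs => ((hD ⟨s, HSet.mem D.2 hs⟩).1 hs).1, ?_, ?_, ?_⟩
  · intro p q hp hpq
    obtain ⟨-, r, a, hr, ha⟩ := (hD ⟨p.1, hcond p⟩).1 hp
    exact (hD ⟨q.1, hcond q⟩).2 ⟨q.2, r, a, Q.trans _ _ _ hr hpq, ha⟩
  · intro p
    obtain ⟨r, a, hr, ha⟩ := hdense ⟨p.1, hcond p⟩ p.2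
    have hrC := (mem_of_pair_mem_rel hr).2
    exact ⟨⟨r.1, hrC⟩, hr, (hD r).2 ⟨hrC, r, a, Q.refl _ hrC, ha⟩⟩
  · intro p hpD hpN
    obtain ⟨-, r, a, hr, ha⟩ := (hD ⟨p.1, hcond p⟩).1 hpD
    obtain ⟨b, hbN, r', hr', hb⟩ := hN.exists_mem (α := Fin 4)
      (R := fun v b => ∃ r : HSet χ, PairMem (v 0) r (v 3) ∧ TripleMem (v 2) (v 1) r b)
      (.ex (.and (.pairMem hω _ _ _) (.tripleMem hω _ _ _ _)))
      ![R, t, E, ⟨p.1, hcond p⟩] (fun i => by fin_cases i <;> assumption) ⟨a, r, hr, ha⟩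
    exact ⟨b.1, hbN, (forcesEq_of_isDecisionSystem (R := R) rfl hE
      (s := ⟨r'.1, (mem_of_pair_mem_rel hr').1⟩) hb).mono hr'⟩

end Submodel

/-! ### Sequences of length less than `lam` -/

section Sequences

variable {lam : Cardinal.{u}}

theorem mk_below : #(Below lam) = Cardinal.lift.{u + 1} lam := by
  rw [Cardinal.mk_Iio_ordinal, card_ord]

/-- An enumeration of a set of size at most `lam` in which every element occurs cofinally often. -/
theorem exists_cofinal_enumeration (hlam : ℵ₀ ≤ lam) {A : Type (u + 1)} [Nonempty A]
    (hA : #A ≤ Cardinal.lift.{u + 1} lam) :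
    ∃ e : Below lam → A, ∀ a β, ∃ γ, β ≤ γ ∧ e γ = a := by
  rw [← mk_below] at hA
  obtain ⟨i⟩ := hA
  have hinf : ℵ₀ ≤ #(Below lam) := by
    rw [mk_below]
    simpa using hlam
  obtain ⟨c⟩ := Cardinal.eq.1 ((Cardinal.mul_def _ _).symm.trans (Cardinal.mul_eq_self hinf))
  refine ⟨fun γ => Function.invFun i (c.symm γ).2, fun a β => ?_⟩
  -- If `a` occurs only below `β`, then `β` has `lam` many predecessors.
  by_contra! hcon
  have hlt : ∀ ξ : Below lam, c (ξ, i a) < β := by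
    intro ξ
    by_contra hξ
    refine hcon _ (not_lt.1 hξ) ?_
    simp only [Equiv.symm_apply_apply]
    exact Function.leftInverse_invFun i.injective a
  let g : Below lam → Set.Iio (β : Ordinal.{u}) := fun ξ => ⟨(c (ξ, i a) : Below lam).1, hlt ξ⟩
  have hg : Function.Injective g := fun ξ ζ h => by
    have h1 : (c (ξ, i a) : Below lam).1 = (c (ζ, i a) : Below lam).1 :=
      congrArg (fun z : Set.Iio (β : Ordinal.{u}) => z.1) h
    exact congrArg Prod.fst (c.injective (Subtype.ext h1))
  have h1 := Cardinal.mk_le_of_injective hg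
  rw [mk_below, Cardinal.mk_Iio_ordinal, Cardinal.lift_le, ← not_lt, ← lt_ord] at h1
  exact h1 β.2

/-- The restriction of the sequence `d` to `γ`, as a set of pairs. -/
noncomputable def seqGraph (d : Below lam → ZFSet.{u}) (γ : Below lam) : ZFSet.{u} :=
  ZFSet.range fun β : Set.Iio γ => ZFSet.pair (β.1 : Ordinal.{u}).toZFSet (d β)

theorem pair_mem_seqGraph {d : Below lam → ZFSet.{u}} {γ : Below lam} {x y : ZFSet.{u}} :
    ZFSet.pair x y ∈ seqGraph d γ ↔ ∃ β < γ, (β : Ordinal.{u}).toZFSet = x ∧ d β = y := by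
  rw [seqGraph, ZFSet.mem_range]
  constructor
  · rintro ⟨β, h⟩
    obtain ⟨h1, h2⟩ := ZFSet.pair_injective h
    exact ⟨β.1, β.2, h1, h2⟩
  · rintro ⟨β, hβ, rfl, rfl⟩
    exact ⟨⟨β, hβ⟩, rfl⟩

theorem isFunc_seqGraph {d : Below lam → ZFSet.{u}} {γ : Below lam} {z : ZFSet.{u}}
    (hd : ∀ β, d β ∈ z) : ZFSet.IsFunc (γ : Ordinal.{u}).toZFSet z (seqGraph d γ) := by
  refine ⟨fun w hw => ?_, fun w hw => ?_⟩
  · obtain ⟨β, rfl⟩ := ZFSet.mem_range.1 hw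
    exact ZFSet.pair_mem_prod.2 ⟨Ordinal.toZFSet_mem_toZFSet_iff.2 β.2, hd _⟩
  · obtain ⟨a, ha, rfl⟩ := Ordinal.mem_toZFSet_iff.1 hw
    refine ⟨d ⟨a, ha.trans γ.2⟩, pair_mem_seqGraph.2 ⟨_, ha, rfl, rfl⟩, fun y hy => ?_⟩
    obtain ⟨β, -, h1, rfl⟩ := pair_mem_seqGraph.1 hy
    congr 1
    exact Subtype.ext (Ordinal.toZFSet_injective h1)

theorem seqGraph_inj {d d' : Below lam → ZFSet.{u}} {γ γ' : Below lam}
    (h : seqGraph d γ = seqGraph d' γ') : γ = γ' ∧ ∀ β < γ, d β = d' β := by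
  have key : ∀ {d d' : Below lam → ZFSet.{u}} {γ γ' : Below lam},
      seqGraph d γ = seqGraph d' γ' → ∀ β < γ, β < γ' ∧ d β = d' β := by
    intro d d' γ γ' h β hβ
    have h1 := (pair_mem_seqGraph (d := d)).2 ⟨β, hβ, rfl, rfl⟩
    rw [h, pair_mem_seqGraph] at h1
    obtain ⟨β', hβ', h2, h3⟩ := h1
    obtain rfl : β' = β := Subtype.ext (Ordinal.toZFSet_injective h2)
    exact ⟨hβ', h3.symm⟩
  refine ⟨le_antisymm ?_ ?_, fun β hβ => (key h β hβ).2⟩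
  · by_contra hlt
    exact lt_irrefl _ (key h _ (not_le.1 hlt)).1
  · by_contra hlt
    exact lt_irrefl _ (key h.symm _ (not_le.1 hlt)).1

theorem IsIndexing.mk_sigma_le (hlam : ℵ₀ ≤ lam) {Y : ∀ α : Below lam, Set (SeqOf α)}
    (hY : IsIndexing Y) : #(Σ α, Y α) ≤ Cardinal.lift.{u + 1} lam := by
  rw [Cardinal.mk_sigma]
  refine (Cardinal.sum_le_sum _ _ fun α => (hY.card_lt α).le).trans ?_
  rw [Cardinal.sum_const, Cardinal.lift_id, Cardinal.lift_id, mk_below, ← Cardinal.lift_mul,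
    Cardinal.mul_eq_self hlam]

end Sequences

/-! ### Properness -/

theorem proposition2p5 (lam : Cardinal.{u}) (hreg : lam.IsRegular) (hunc : ℵ₀ < lam)
    (hpow : lam ^< lam = lam)
    (f : Below lam → Set.Iic lam.ord) (hf : ∀ α : Below lam, ω + (α : Ordinal.{u}) < f α)
    (D : Filter (Below lam)) (hD : IsNormalFilter D)
    (Y : ∀ α : Below lam, Set (SeqOf α)) (hY : IsIndexing Y)
    (Q : ForcingNotion.{u}) (hQ : SemiPurelyProper f Y D Q.Le) :
    Q.IsProper lam := by
  classical
  have hlam : ℵ₀ ≤ lam := hreg.aleph0_le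
  have hlim : Order.IsSuccLimit lam.ord := isSuccLimit_ord hlam
  obtain ⟨play, hlocal, hcapture⟩ := hQ.exists_play hlam hf hD
  let o : Below lam := ⟨0, Set.mem_Iio.2 hlim.bot_lt⟩
  let i : Below lam := ⟨1, Set.mem_Iio.2 (one_lt_omega0.trans_le (omega0_le_of_isSuccLimit hlim))⟩
  have hoi : o < i := show (0 : Ordinal.{u}) < 1 from zero_lt_one
  have : Nonempty (Σ α, Y α) := ⟨⟨o, (hY.nonempty o).some, (hY.nonempty o).some_mem⟩⟩
  obtain ⟨dec, hdec⟩ := exists_cofinal_enumeration hlam (hY.mk_sigma_le hlam)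
  -- The entry at `0` of a sequence is read as a condition, all entries as sets of conditions.
  let B : ZFSet.{u} := Q.carrier ∪ Q.carrier.powerset
  let start : ZFSet.{u} → Q.Cond := fun z => if h : z ∈ Q.carrier then ⟨z, h⟩ else Q.botCond
  let val : (Below lam → B) → Below lam → Q.Cond := fun d γ =>
    play (start (d o)) (fun β => {c | c.1 ∈ (d β).1}) (dec γ).1 (dec γ).2
  -- `x` maps the restriction of `d` to `γ` to the entry of the play whose index is coded by `γ`.
  let I := {z : (Below lam → B) × Below lam // o < z.2 ∧ (dec z.2).1 ≤ z.2}
  let x : ZFSet.{u} := ZFSet.range fun z : I =>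
    ZFSet.pair (seqGraph (fun β => (z.1.1 β).1) z.1.2) (val z.1.1 z.1.2).1
  have hx : ∀ (d : Below lam → B) (γ : Below lam), o < γ → (dec γ).1 ≤ γ →
      ZFSet.pair (seqGraph (fun β => (d β).1) γ) (val d γ).1 ∈ x ∧
      ∀ w, ZFSet.pair (seqGraph (fun β => (d β).1) γ) w ∈ x → w = (val d γ).1 := by
    intro d γ h1 h2
    refine ⟨ZFSet.mem_range.2 ⟨⟨(d, γ), h1, h2⟩, rfl⟩, fun w hw => ?_⟩
    obtain ⟨⟨⟨d', γ'⟩, h1', h2'⟩, hz⟩ := ZFSet.mem_range.1 hw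
    obtain ⟨hgraph, rfl⟩ := ZFSet.pair_injective hz
    obtain ⟨rfl, hdd'⟩ := seqGraph_inj hgraph
    simp only at h1' h2' hdd'
    change (play (start (d' o)) (fun β => {c | c.1 ∈ (d' β).1}) (dec γ').1 (dec γ').2).1 =
      (play (start (d o)) (fun β => {c | c.1 ∈ (d β).1}) (dec γ').1 (dec γ').2).1
    rw [hdd' o h1', hlocal _ _ _ (dec γ').1 fun β hβ => ?_]
    rw [hdd' β (hβ.trans_le h2')]
  obtain ⟨χ₀, hχ₀⟩ := exists_forall_mem_hSet x
  refine ⟨χ₀, fun χ hχ hχr W _ => ⟨x, hχ₀ χ hχ, fun N hN hclosed hcard hQN hxN q hq => ?_⟩⟩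
  -- an enumeration of all conditions and all sets of conditions in `N`, starting with `q`
  let A := {z : B // z.1 ∈ N}
  let q' : A := ⟨⟨q.1, ZFSet.mem_union.2 (Or.inl q.2)⟩, hq⟩
  have : Nonempty A := ⟨q'⟩
  have hA : #A ≤ Cardinal.lift.{u + 1} lam := by
    rw [← hcard, ← ZFSet.cardinalMk_coe_sort]
    refine Cardinal.mk_le_of_injective (f := fun z : A => (⟨z.1.1, z.2⟩ : N)) fun z w h => ?_
    exact Subtype.ext (Subtype.ext (congrArg (fun z : N => z.1) h))
  obtain ⟨e, he⟩ := exists_cofinal_enumeration hlam hA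
  let d : Below lam → B := fun β => (Function.update e o q' β).1
  have hdN : ∀ β, (d β).1 ∈ N := fun β => (Function.update e o q' β).2
  have hd : ∀ z ∈ N, z ⊆ Q.carrier → ∃ β, (d β).1 = z := by
    intro z hz hzQ
    obtain ⟨β, hβ, heβ⟩ := he ⟨⟨z, ZFSet.mem_union.2 (Or.inr (ZFSet.mem_powerset.2 hzQ))⟩, hz⟩ i
    refine ⟨β, ?_⟩
    change (Function.update e o q' β).1.1 = z
    rw [Function.update_of_ne (hoi.trans_le hβ).ne', heβ]
  have hstart : start (d o) = q := by
    have : (d o).1 = q.1 := by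
      change (Function.update e o q' o).1.1 = q.1
      rw [Function.update_self]
    rw [this]
    exact dif_pos q.2
  obtain ⟨p, hqp, hp⟩ := hcapture q fun β => {c | c.1 ∈ (d β).1}
  have hplay : ∀ α η, (play q (fun β => {c | c.1 ∈ (d β).1}) α η).1 ∈ N := by
    intro α η
    obtain ⟨γ, hγ, hdecγ⟩ := hdec ⟨α, η⟩ (max α i)
    have h1 : o < γ := hoi.trans_le ((le_max_right _ _).trans hγ)
    have h2 : (dec γ).1 ≤ γ := by
      rw [hdecγ]
      exact (le_max_left _ _).trans hγ
    have hval : val d γ = play q (fun β => {c | c.1 ∈ (d β).1}) α η := by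
      change play (start (d o)) (fun β => {c | c.1 ∈ (d β).1}) (dec γ).1 (dec γ).2 = _
      rw [hstart, hdecγ]
    rw [← hval]
    exact hN.apply_mem hχr.aleph0_le hxN (hclosed γ γ.2 _ (isFunc_seqGraph hdN))
      (hx d γ h1 h2).1 (hx d γ h1 h2).2
  refine ⟨p, hqp, fun τ hτN hτ r hr => ?_⟩
  obtain ⟨E, hEN, hEQ, hup, hdense, hdecide⟩ := hτ.exists_dense_mem hχr hN hQN hτN
  obtain ⟨β, hβ⟩ := hd E hEN hEQ
  obtain ⟨s, hrs, hsE⟩ := hdense r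
  obtain ⟨α, η, r', hsr', hle, hmem⟩ := hp β
    (fun b c hb hbc => by
      simp only [Set.mem_ofPred_eq, hβ] at hb ⊢
      exact hup b c hb hbc)
    s (hr.trans hrs) (by simpa only [Set.mem_ofPred_eq, hβ] using hsE)
  simp only [Set.mem_ofPred_eq, hβ] at hmem
  obtain ⟨a, haN, ha⟩ := hdecide _ hmem (hplay α η)
  exact ⟨r', hrs.trans hsr', _, Q.botCond, ForcingNotion.pair_mem_check.2 ⟨a, haN, rfl, rfl⟩,
    ForcingNotion.botCond_le _, ha.mono hle⟩
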